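/- Let $a>b>0$. A 3-periodic of the elliptic billiard with boundary $(x/a)^2+(y/b)^2=1$ is a triangle $P_1P_2P_3$ inscribed in this ellipse such that at every vertex the two sides make equal angles with the normal of the ellipse. Its anticomplementary triangle (ACT) $P_1'P_2'P_3'$ is its image under the homothety of ratio $-2$ about its barycenter, and the ACT intouchpoints $i_1',i_2',i_3'$ are the points where the incircle of the ACT touches its sides $P_2'P_3'$, $P_3'P_1'$, $P_1'P_2'$. For all $a>b>0$ there is a continuous family $P_1(t)P_2(t)P_3(t)$, $t\in\mathbb R$, of 3-periodics with $P_1(t)=(a\cos t,b\sin t)$. Let $\alpha_{act}=2\sqrt{2/5}$. For every such family and every $k\in\{1,2,3\}$, the intouchpoint $i_k'(t)$ of the ACT of $P_1(t)P_2(t)P_3(t)$ stays on the ellipse, and $i_k'(t)=(a\cos\theta(t),b\sin\theta(t))$ for a differentiable function $\theta:\mathbb R\to\mathbb R$ with $\theta(t+2\pi)=\theta(t)+2\pi$, such that: 1. If $a/b<\alpha_{act}$, the motion is monotonic in the (counterclockwise) direction of $P_1(t)$: $\theta$ is strictly increasing, and $\theta'(t)>0$ for all $t$. 2. If $a/b=\alpha_{act}$,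 the motion is monotonic in the direction of $P_1(t)$, except for two instantaneous stops in each circuit, at the top and bottom vertices: $\theta$ is strictly increasing, and there are $t_1<t_2<t_1+2\pi$ with $i_k'(t_1)=(0,b)$, $i_k'(t_2)=(0,-b)$, $\theta'(t_1)=\theta'(t_2)=0$, and $\theta'>0$ on $(t_1,t_2)$ and on $(t_2,t_1+2\pi)$. 3. If $a/b>\alpha_{act}$, the motion is not monotonic, and has four reversals of velocity in each circuit: there are $t_1<t_2<t_3<t_4<t_1+2\pi$ such that $\theta'=0$ at $t_1,t_2,t_3,t_4$, $\theta'<0$ on $(t_1,t_2)$ and $(t_3,t_4)$, and $\theta'>0$ on $(t_2,t_3)$ and $(t_4,t_1+2\pi)$. The first pair of reversals is about the top vertex: $i_k'(t_1)$ lies in the open second quadrant, $i_k'(t_2)$ in the open first quadrant, and $i_k'(t)=(0,b)$ for some $t\in(t_1,t_2)$. The second pair is about the bottom vertex: $i_k'(t_3)$ lies in the open fourth quadrant, $i_k'(t_4)$ in the open third quadrant, and $i_k'(t)=(0,-b)$ for some $t\in(t_3,t_4)$. Moreover, the reversals are near the top and bottom vertices in the following sense: for every $\varepsilon>0$ there is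 $\eta>0$ such that whenever $b>0$ and $\alpha_{act}<a/b<\alpha_{act}+\eta$, for every family and every $k$ as above, and every differentiable $\theta$ with $i_k'(t)=(a\cos\theta(t),b\sin\theta(t))$ for all $t$, each $i_k'(t)$ with $\theta'(t)=0$ lies at distance less than $\varepsilon b$ from $(0,b)$ or from $(0,-b)$. -/

import Mathlib

/-- The Euclidean plane. -/
abbrev Plane : Type := EuclideanSpace ℝ (Fin 2)

noncomputable section

/-- The point `(a cos t, b sin t)` of the ellipse `(x/a)² + (y/b)² = 1`. -/
def ellipsePoint (a b t : ℝ) : Plane := !₂[a * Real.cos t, b * Real.sin t]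

/-- The boundary of the elliptic billiard with semi-axes `a`, `b`. -/
def ellipse (a b : ℝ) : Set Plane := {p | (p 0 / a) ^ 2 + (p 1 / b) ^ 2 = 1}

/-- The inward normal of the ellipse at its point `p`
(minus one half of the gradient of `(x/a)² + (y/b)²`). -/
def inwardNormal (a b : ℝ) (p : Plane) : Plane := !₂[-(p 0 / a ^ 2), -(p 1 / b ^ 2)]

/-- `T` is a 3-periodic of the elliptic billiard: it is inscribed in the ellipse, and at each
vertex the two sides make the same angle with the normal (angle of incidence = angle of
reflection). -/
structure IsThreePeriodic (a b : ℝ) (T : Affine.Triangle ℝ Plane) : Prop where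
  mem_ellipse : ∀ i : Fin 3, T.points i ∈ ellipse a b
  reflection : ∀ i : Fin 3,
    InnerProductGeometry.angle (T.points (i + 1) - T.points i) (inwardNormal a b (T.points i)) =
      InnerProductGeometry.angle (T.points (i + 2) - T.points i) (inwardNormal a b (T.points i))

/-- The family `P₁(t)P₂(t)P₃(t)` of 3-periodics, parametrized by the leading vertex
`P₁(t) = (a cos t, b sin t)` and moving continuously. The vertices `P₁, P₂, P₃` are indexed by
`0, 1, 2`. -/
structure IsThreePeriodicFamily (a b : ℝ) (T : ℝ → Affine.Triangle ℝ Plane) : Prop where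
  isThreePeriodic : ∀ t, IsThreePeriodic a b (T t)
  leading : ∀ t, (T t).points 0 = ellipsePoint a b t
  continuous : ∀ i : Fin 3, Continuous fun t => (T t).points i

theorem homothety_neg_two_injective (c : Plane) :
    Function.Injective (AffineMap.homothety c (-2 : ℝ)) := by
  intro p q h
  simpa [AffineMap.homothety_apply] using h

/-- The anticomplementary triangle (ACT): the image of `T` under the homothety of ratio `-2`
about the barycenter; its `i`-th vertex is the reflection, at double length, of the `i`-th vertex
of `T` about the barycenter. -/
def anticomplementary (T : Affine.Triangle ℝ Plane) : Affine.Triangle ℝ Plane :=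
  T.map (AffineMap.homothety T.centroid (-2 : ℝ)) (homothety_neg_two_injective _)

/-- The `i`-th intouchpoint of the anticomplementary triangle: the foot of the perpendicular
dropped from the incenter of the ACT onto the side opposite to its `i`-th vertex, that is, the
point where the incircle of the ACT touches that side. -/
def actIntouchpoint (T : Affine.Triangle ℝ Plane) (i : Fin 3) : Plane :=
  (anticomplementary T).touchpoint ∅ i

/-- The top vertex `(0, b)` of the ellipse. -/
def topVertex (b : ℝ) : Plane := !₂[0, b]

/-- The bottom vertex `(0, -b)` of the ellipse. -/
def bottomVertex (b : ℝ) : Plane := !₂[0, -b]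

/-- `θ` is a differentiable angular coordinate of the moving point `Q` on the ellipse. The velocity
of `Q` is then `θ'(t) • (-a sin θ(t), b cos θ(t))`, so `Q` moves counterclockwise, stands still or
moves clockwise according to the sign of `deriv θ t`. The leading vertex `P₁(t)` has the angular
coordinate `t`, so it moves counterclockwise. -/
structure IsAngularCoordinate (a b : ℝ) (Q : ℝ → Plane) (θ : ℝ → ℝ) : Prop where
  differentiable : Differentiable ℝ θ
  eq_point : ∀ t, Q t = ellipsePoint a b (θ t)

/-- The motion of `Q` on the ellipse, with angular coordinate `θ`, is monotonic in the direction of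
`P₁(t)`, without any stop. -/
def MovesForward (θ : ℝ → ℝ) : Prop :=
  StrictMono θ ∧ ∀ t, 0 < deriv θ t

/-- The motion of `Q` is monotonic in the direction of `P₁(t)`, except for exactly two instantaneous
stops in each circuit, one at the top and one at the bottom vertex. -/
def MovesForwardWithTwoStops (b : ℝ) (Q : ℝ → Plane) (θ : ℝ → ℝ) : Prop :=
  StrictMono θ ∧ ∃ t₁ t₂ : ℝ, t₁ < t₂ ∧ t₂ < t₁ + 2 * Real.pi ∧
    Q t₁ = topVertex b ∧ deriv θ t₁ = 0 ∧
    Q t₂ = bottomVertex b ∧ deriv θ t₂ = 0 ∧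
    (∀ t ∈ Set.Ioo t₁ t₂, 0 < deriv θ t) ∧
    (∀ t ∈ Set.Ioo t₂ (t₁ + 2 * Real.pi), 0 < deriv θ t)

/-- The motion of `Q` is not monotonic: in each circuit the velocity reverses exactly four times, at
`t₁ < t₂ < t₃ < t₄`. The first two reversals take place on the upper half of the ellipse, on
the two sides of the top vertex, which is crossed backwards between them; the other two take place
on the lower half, on the two sides of the bottom vertex, crossed backwards between them. -/
def MovesWithFourReversals (b : ℝ) (Q : ℝ → Plane) (θ : ℝ → ℝ) : Prop :=
  ¬ Monotone θ ∧ ∃ t₁ t₂ t₃ t₄ : ℝ,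
    t₁ < t₂ ∧ t₂ < t₃ ∧ t₃ < t₄ ∧ t₄ < t₁ + 2 * Real.pi ∧
    deriv θ t₁ = 0 ∧ deriv θ t₂ = 0 ∧ deriv θ t₃ = 0 ∧ deriv θ t₄ = 0 ∧
    (∀ t ∈ Set.Ioo t₁ t₂, deriv θ t < 0) ∧
    (∀ t ∈ Set.Ioo t₂ t₃, 0 < deriv θ t) ∧
    (∀ t ∈ Set.Ioo t₃ t₄, deriv θ t < 0) ∧
    (∀ t ∈ Set.Ioo t₄ (t₁ + 2 * Real.pi), 0 < deriv θ t) ∧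
    (Q t₁ 0 < 0 ∧ 0 < Q t₁ 1) ∧ (0 < Q t₂ 0 ∧ 0 < Q t₂ 1) ∧
    (∃ t ∈ Set.Ioo t₁ t₂, Q t = topVertex b) ∧
    (0 < Q t₃ 0 ∧ Q t₃ 1 < 0) ∧ (Q t₄ 0 < 0 ∧ Q t₄ 1 < 0) ∧
    (∃ t ∈ Set.Ioo t₃ t₄, Q t = bottomVertex b)

/-- The threshold aspect ratio `α_act = 2 √(2/5)`. -/
def alphaAct : ℝ := 2 * Real.sqrt (2 / 5)

end

/-!
The affine map onto the unit circle turns the vertices `(a cos s, b sin s)` of a triangle inscribed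
in the ellipse into unit complex numbers `z = cis s`. The square of a side is
`(1 - cos (sᵢ - sⱼ)) (a² + b² - (a² - b²) cos (sᵢ + sⱼ))`, and the inner product of the side with
the normal at either end is `1 - cos (sᵢ - sⱼ)`. Hence the reflection law says that the sides are
proportional to `1 - cos (sᵢ - sⱼ)`, which is equivalent to `z₁ + z₂ + z₃ = -c z₁ z₂ z₃` for a
constant `c ∈ (0, 1)` with `2c (a² + b²) = (3 - c²) (a² - b²)` (`IsThreePeriodic.isPoncelet`,
`isThreePeriodic_of_isPoncelet`). These triples are the fibres of the Blaschke product
`B(z) = z (z² - c) / (1 - c z²)`. Its argument `blaschkeAngle` is an increasing diffeomorphism of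
`ℝ`; this gives the families of 3-periodics, and shows that in every family each vertex runs
through the circle by a diffeomorphism (`IsThreePeriodicFamily.exists_isCircleLift`).

The incircle of the anticomplementary triangle touches the side through `Pᵢ` at
`Pᵢ + ((|PᵢPⱼ| - |PᵢPₖ|) / |PⱼPₖ|) (Pⱼ - Pₖ)` (`actIntouchpoint_eq`). As the sides are proportional
to `1 - cos (sᵢ - sⱼ)`, this is the point of the ellipse that corresponds to
`zⱼ zₖ / zᵢ = B(zᵢ) / zᵢ² = (zᵢ² - c) / (zᵢ (1 - c zᵢ²))`: a function of `zᵢ` alone. Its argument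
`intouchAngle c s` has a derivative with the sign of `(1 - 3c) (1 + c) + 4c cos² s`
(`exists_hasDerivAt_intouchAngle`), so that everything depends on the sign of `3c - 1`, which is
that of `a / b - alphaAct` (`ponceletParameter_threshold`). When the derivative vanishes, the point
is `(z - 3c z⁻¹) / 2` (`cos_sin_intouchAngle_of_stop`), whence the quadrants of the reversals, and
their distance from the line `x = 0`.
-/

open Affine Affine.Simplex EuclideanGeometry

/-! ### Intouchpoints of a triangle and of its anticomplementary triangle -/

/-- The tangent lengths from the `j`-th vertex of a triangle are equal to the semiperimeter minus
the opposite side. -/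
theorem two_mul_dist_touchpoint (t : Affine.Triangle ℝ Plane) {i j k : Fin 3}
    (hij : i ≠ j) (hik : i ≠ k) (hjk : j ≠ k) :
    2 * dist (t.points j) (t.touchpoint ∅ i) =
      dist (t.points i) (t.points j) + dist (t.points j) (t.points k)
        - dist (t.points k) (t.points i) := by
  have tangent : ∀ {p q r : Fin 3}, p ≠ q → p ≠ r → q ≠ r →
      dist (t.points p) (t.touchpoint ∅ q) = dist (t.points p) (t.touchpoint ∅ r) := by
    intro p q r hpq hpr hqr
    refine (t.isTangentAt_insphere_touchpoint q).dist_eq_of_mem_of_mem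
      (t.isTangentAt_insphere_touchpoint r) ?_ ?_ <;>
    · apply subset_affineSpan
      simp only [range_faceOpposite_points]
      exact ⟨p, by simpa, rfl⟩
  have hi := (t.sbtw_touchpoint_empty hij.symm hjk hik).wbtw.dist_add_dist
  have hj := (t.sbtw_touchpoint_empty hij hik hjk).wbtw.dist_add_dist
  have hk := (t.sbtw_touchpoint_empty hik hij hjk.symm).wbtw.dist_add_dist
  have ti := tangent hij hik hjk
  have tj := tangent hij.symm hjk hik
  have tk := tangent hik.symm hjk.symm hij
  simp only [dist_comm (t.touchpoint ∅ _) (t.points _)] at hi hj hk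
  rw [dist_comm (t.points k) (t.points i)]
  linarith

theorem touchpoint_eq_lineMap (t : Affine.Triangle ℝ Plane) {i j k : Fin 3}
    (hij : i ≠ j) (hik : i ≠ k) (hjk : j ≠ k) :
    t.touchpoint ∅ i = AffineMap.lineMap (t.points j) (t.points k)
      ((dist (t.points i) (t.points j) + dist (t.points j) (t.points k)
        - dist (t.points k) (t.points i)) / (2 * dist (t.points j) (t.points k))) := by
  have hpos : 0 < dist (t.points j) (t.points k) := dist_pos.2 (t.independent.injective.ne hjk)
  obtain ⟨r, hr, h⟩ := (t.sbtw_touchpoint_empty hij.symm hjk hik).wbtw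
  have hd := two_mul_dist_touchpoint t hij hik hjk
  rw [← h, dist_left_lineMap, Real.norm_of_nonneg hr.1] at hd
  rw [← h, ← hd]
  congr 1
  field_simp

theorem anticomplementary_points (T : Affine.Triangle ℝ Plane) {i j k : Fin 3}
    (hij : i ≠ j) (hik : i ≠ k) (hjk : j ≠ k) :
    (anticomplementary T).points i = T.points j + T.points k - T.points i := by
  have hc : T.centroid = (1 / 3 : ℝ) • (T.points i + T.points j + T.points k) := by
    have hs : ∑ l, T.points l = T.points i + T.points j + T.points k := by
      rw [(by clear * - hij hik hjk; decide +revert : (Finset.univ : Finset (Fin 3)) = {i, j, k}),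
        Finset.sum_insert (by simp [hij, hik]), Finset.sum_pair hjk, add_assoc]
    rw [centroid_eq_smul_sum_vsub_vadd T i]
    simp only [vsub_eq_sub, vadd_eq_add, Finset.sum_sub_distrib, hs]
    simp
    module
  simp only [anticomplementary, map_points, Function.comp_apply, AffineMap.homothety_apply, hc,
    vsub_eq_sub, vadd_eq_add]
  module

/-- The intouchpoint of the anticomplementary triangle on the side through `Pᵢ` is displaced from
`Pᵢ` by the difference of the two sides of the original triangle at `Pᵢ`. -/
theorem actIntouchpoint_eq (T : Affine.Triangle ℝ Plane) {i j k : Fin 3}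
    (hij : i ≠ j) (hik : i ≠ k) (hjk : j ≠ k) :
    actIntouchpoint T i = T.points i +
      ((dist (T.points i) (T.points j) - dist (T.points i) (T.points k)) /
        dist (T.points j) (T.points k)) • (T.points j - T.points k) := by
  have hpos : 0 < dist (T.points j) (T.points k) := dist_pos.2 (T.independent.injective.ne hjk)
  have hi := anticomplementary_points T hij hik hjk
  have hj := anticomplementary_points T hij.symm hjk hik
  have hk := anticomplementary_points T hik.symm hjk.symm hij
  have hdist : ∀ x y z : Plane, dist (x + y - z) (z + y - x) = 2 * dist z x := by
    intro x y z
    rw [dist_eq_norm, dist_eq_norm, ← norm_neg (z - x), neg_sub]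
    rw [show x + y - z - (z + y - x) = (2 : ℝ) • (x - z) by module, norm_smul]
    norm_num
  have d1 : dist ((anticomplementary T).points i) ((anticomplementary T).points j)
      = 2 * dist (T.points i) (T.points j) := by rw [hi, hj, hdist]
  have d2 : dist ((anticomplementary T).points j) ((anticomplementary T).points k)
      = 2 * dist (T.points j) (T.points k) := by
    rw [hj, hk, add_comm (T.points i) (T.points k), add_comm (T.points i) (T.points j), hdist]
  have d3 : dist ((anticomplementary T).points k) ((anticomplementary T).points i)
      = 2 * dist (T.points i) (T.points k) := by
    rw [hi, hk, add_comm (T.points j) (T.points k), hdist, dist_comm]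
  rw [actIntouchpoint, touchpoint_eq_lineMap _ hij hik hjk, d1, d2, d3, hj, hk,
    AffineMap.lineMap_apply, vsub_eq_sub, vadd_eq_add]
  have : (2 * dist (T.points i) (T.points j) + 2 * dist (T.points j) (T.points k)
      - 2 * dist (T.points i) (T.points k)) / (2 * (2 * dist (T.points j) (T.points k)))
      = 1 / 2 + (dist (T.points i) (T.points j) - dist (T.points i) (T.points k)) /
        dist (T.points j) (T.points k) / 2 := by
    field_simp
    ring
  rw [this]
  module

/-! ### Points of the unit circle -/

/-- The point of the unit circle of `ℂ` with argument `s`. -/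
noncomputable def cis (s : ℝ) : ℂ := Complex.exp (s * Complex.I)

theorem cis_ne_zero (s : ℝ) : cis s ≠ 0 := Complex.exp_ne_zero _

theorem cis_eq (s : ℝ) : cis s = Real.cos s + Real.sin s * Complex.I := by
  rw [cis, Complex.exp_mul_I, Complex.ofReal_cos, Complex.ofReal_sin]

theorem cis_re (s : ℝ) : (cis s).re = Real.cos s := Complex.exp_ofReal_mul_I_re s

theorem cis_im (s : ℝ) : (cis s).im = Real.sin s := Complex.exp_ofReal_mul_I_im s

theorem cis_add (s t : ℝ) : cis (s + t) = cis s * cis t := by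
  simp only [cis]
  rw [← Complex.exp_add]
  push_cast
  ring_nf

theorem cis_neg (s : ℝ) : cis (-s) = (cis s)⁻¹ := by
  rw [cis, cis, ← Complex.exp_neg]
  push_cast
  ring_nf

theorem cis_two_mul (s : ℝ) : cis (2 * s) = cis s ^ 2 := by
  rw [two_mul, cis_add, sq]

theorem star_cis (s : ℝ) : (starRingEnd ℂ) (cis s) = (cis s)⁻¹ := by
  rw [← cis_neg, cis, cis, ← Complex.exp_conj]
  simp

theorem cis_eq_cis_iff {s t : ℝ} : cis s = cis t ↔ ∃ n : ℤ, s = t + 2 * Real.pi * n := by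
  rw [cis, cis, Complex.exp_eq_exp_iff_exists_int]
  refine exists_congr fun n => ?_
  rw [show (t * Complex.I + n * (2 * Real.pi * Complex.I) : ℂ) =
    ((t + 2 * Real.pi * n : ℝ) : ℂ) * Complex.I by push_cast; ring,
    mul_left_inj' Complex.I_ne_zero, Complex.ofReal_inj]

theorem cis_eq_cis_iff_cos_sin {s t : ℝ} :
    cis s = cis t ↔ Real.cos s = Real.cos t ∧ Real.sin s = Real.sin t := by
  rw [Complex.ext_iff, cis_re, cis_re, cis_im, cis_im]

theorem two_mul_cos_sub (s t : ℝ) :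
    (2 * Real.cos (s - t) : ℂ) * (cis s * cis t) = cis s ^ 2 + cis t ^ 2 := by
  rw [show (2 * Real.cos (s - t) : ℂ) = cis (s - t) + cis (-(s - t)) by
    simp only [cis_eq, Real.cos_neg, Real.sin_neg]; push_cast; ring,
    neg_sub, sub_eq_add_neg, sub_eq_add_neg, cis_add, cis_add, cis_neg, cis_neg]
  have := cis_ne_zero s
  have := cis_ne_zero t
  field_simp

theorem two_mul_cos_add (s t : ℝ) :
    (2 * Real.cos (s + t) : ℂ) * (cis s * cis t) = cis s ^ 2 * cis t ^ 2 + 1 := by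
  rw [show (2 * Real.cos (s + t) : ℂ) = cis (s + t) + cis (-(s + t)) by
    simp only [cis_eq, Real.cos_neg, Real.sin_neg]; push_cast; ring,
    cis_neg, cis_add]
  have := cis_ne_zero s
  have := cis_ne_zero t
  field_simp

theorem cos_sub_lt_one {s t : ℝ} (h : cis s ≠ cis t) : Real.cos (s - t) < 1 := by
  refine lt_of_le_of_ne (Real.cos_le_one _) fun h1 => h ?_
  have := two_mul_cos_sub s t
  rw [h1] at this
  have h2 : (cis s - cis t) ^ 2 = 0 := by
    push_cast at this
    linear_combination -this
  exact sub_eq_zero.1 (pow_eq_zero_iff (two_ne_zero)|>.1 h2)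

/-! ### Poncelet triples -/

/-- The triples of complex numbers with `z₁ + z₂ + z₃ = -c z₁ z₂ z₃`, for a real `c`. They are used
for three different points of the unit circle and `0 < c < 1`: these triples are the fibres of the
Blaschke product `z (z² - c) / (1 - c z²)`, and the triangles inscribed in the unit circle and
circumscribed about the ellipse with foci `±√c` and major axis `1 + c`. -/
def IsPoncelet (c : ℝ) (z₁ z₂ z₃ : ℂ) : Prop := z₁ + z₂ + z₃ = -c * (z₁ * z₂ * z₃)

theorem IsPoncelet.rotate {c : ℝ} {z₁ z₂ z₃ : ℂ} (h : IsPoncelet c z₁ z₂ z₃) :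
    IsPoncelet c z₂ z₃ z₁ := by
  unfold IsPoncelet at *
  linear_combination h

/-- The second symmetric function of a Poncelet triple: the conjugate of the defining equation. -/
theorem IsPoncelet.sum_mul {c s₁ s₂ s₃ : ℝ} (h : IsPoncelet c (cis s₁) (cis s₂) (cis s₃)) :
    cis s₁ * cis s₂ + cis s₂ * cis s₃ + cis s₃ * cis s₁ = -c := by
  have h' := congrArg (starRingEnd ℂ) h
  simp only [map_add, map_mul, map_neg, star_cis, Complex.conj_ofReal] at h'
  have := cis_ne_zero s₁
  have := cis_ne_zero s₂
  have := cis_ne_zero s₃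
  field_simp at h'
  linear_combination h'

/-- Each member of a Poncelet triple solves `z (z² - c) = λ (1 - c z²)` with `λ = z₁ z₂ z₃`. -/
theorem IsPoncelet.blaschke_eq {c s₁ s₂ s₃ : ℝ} (h : IsPoncelet c (cis s₁) (cis s₂) (cis s₃)) :
    cis s₁ * (cis s₁ ^ 2 - c) = cis s₁ * cis s₂ * cis s₃ * (1 - c * cis s₁ ^ 2) := by
  have h2 := h.sum_mul
  unfold IsPoncelet at h
  linear_combination (cis s₁) ^ 2 * h - cis s₁ * h2

/-- Three different solutions of `z (z² - c) = λ (1 - c z²)` form a Poncelet triple. -/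
theorem isPoncelet_of_blaschke_eq {c : ℝ} {l z₁ z₂ z₃ : ℂ}
    (h₁₂ : z₁ ≠ z₂) (h₁₃ : z₁ ≠ z₃) (h₂₃ : z₂ ≠ z₃)
    (h₁ : z₁ * (z₁ ^ 2 - c) = l * (1 - c * z₁ ^ 2))
    (h₂ : z₂ * (z₂ ^ 2 - c) = l * (1 - c * z₂ ^ 2))
    (h₃ : z₃ * (z₃ ^ 2 - c) = l * (1 - c * z₃ ^ 2)) :
    IsPoncelet c z₁ z₂ z₃ := by
  have a : z₁ ^ 2 + z₁ * z₂ + z₂ ^ 2 + c * l * (z₁ + z₂) - c = 0 :=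
    mul_left_cancel₀ (sub_ne_zero.2 h₁₂) (by linear_combination h₁ - h₂)
  have b : z₁ ^ 2 + z₁ * z₃ + z₃ ^ 2 + c * l * (z₁ + z₃) - c = 0 :=
    mul_left_cancel₀ (sub_ne_zero.2 h₁₃) (by linear_combination h₁ - h₃)
  have e : z₁ + z₂ + z₃ + c * l = 0 :=
    mul_left_cancel₀ (sub_ne_zero.2 h₂₃) (by linear_combination a - b)
  have f : l = z₁ * z₂ * z₃ := by linear_combination z₁ * a - z₁ * z₂ * e - h₁
  unfold IsPoncelet
  linear_combination e - c * f

/-- For a Poncelet triple, `1 - cos (s₁ - s₂)` is an affine function of `cos (s₁ + s₂)`. -/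
theorem IsPoncelet.one_sub_cos_eq {c s₁ s₂ s₃ : ℝ} (h : IsPoncelet c (cis s₁) (cis s₂) (cis s₃)) :
    2 * (1 - Real.cos (s₁ - s₂)) = 3 - c ^ 2 - 2 * c * Real.cos (s₁ + s₂) := by
  have h2 := h.sum_mul
  have e1 := two_mul_cos_sub s₁ s₂
  have e2 := two_mul_cos_add s₁ s₂
  unfold IsPoncelet at h
  have h3 : cis s₁ * cis s₂ ≠ 0 := mul_ne_zero (cis_ne_zero _) (cis_ne_zero _)
  have key : (2 * (1 - Real.cos (s₁ - s₂)) : ℂ) = 3 - c ^ 2 - 2 * c * Real.cos (s₁ + s₂) := by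
    refine mul_right_cancel₀ h3 ?_
    linear_combination (-1) * e1 + c * e2 + (1 + c * cis s₁ * cis s₂) * h2
      - (cis s₁ + cis s₂) * h
  exact_mod_cast key

/-- Three different points of the unit circle such that `1 - cos (sᵢ - sⱼ)` is the same affine
function of `cos (sᵢ + sⱼ)` for all pairs form a Poncelet triple. -/
theorem isPoncelet_of_one_sub_cos_eq {c m s₁ s₂ s₃ : ℝ}
    (h₁₂ : cis s₁ ≠ cis s₂) (h₁₃ : cis s₁ ≠ cis s₃) (h₂₃ : cis s₂ ≠ cis s₃)
    (e₁₂ : 1 - Real.cos (s₁ - s₂) = m - c * Real.cos (s₁ + s₂))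
    (e₁₃ : 1 - Real.cos (s₁ - s₃) = m - c * Real.cos (s₁ + s₃))
    (e₂₃ : 1 - Real.cos (s₂ - s₃) = m - c * Real.cos (s₂ + s₃)) :
    IsPoncelet c (cis s₁) (cis s₂) (cis s₃) ∧ 2 * m = 3 - c ^ 2 := by
  have conic : ∀ {s t : ℝ}, 1 - Real.cos (s - t) = m - c * Real.cos (s + t) →
      c * (1 + cis s ^ 2 * cis t ^ 2) + 2 * (1 - m) * (cis s * cis t) - cis s ^ 2 - cis t ^ 2
        = 0 := by
    intro s t h
    have h' : (1 - Real.cos (s - t) : ℂ) = m - c * Real.cos (s + t) := by exact_mod_cast h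
    linear_combination (2 * (cis s * cis t)) * h' + two_mul_cos_sub s t - c * two_mul_cos_add s t
  have a := conic e₁₂
  have b := conic e₁₃
  have d := conic e₂₃
  set z₁ := cis s₁
  set z₂ := cis s₂
  set z₃ := cis s₃
  -- `z₂`, `z₃` are the roots of a quadratic with coefficients in `z₁`; this is their sum.
  have p : (c * (z₁ * z₂ + z₂ * z₃ + z₃ * z₁) + 3 - 2 * m) * z₁
      = z₁ + z₂ + z₃ + c * (z₁ * z₂ * z₃) :=
    mul_left_cancel₀ (sub_ne_zero.2 h₂₃) (by linear_combination a - b)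
  have q : (c * (z₁ * z₂ + z₂ * z₃ + z₃ * z₁) + 3 - 2 * m) * z₂
      = z₁ + z₂ + z₃ + c * (z₁ * z₂ * z₃) :=
    mul_left_cancel₀ (sub_ne_zero.2 h₁₃) (by linear_combination a - d)
  have r : c * (z₁ * z₂ + z₂ * z₃ + z₃ * z₁) + 3 - 2 * m = 0 :=
    mul_left_cancel₀ (sub_ne_zero.2 h₁₂) (by linear_combination p - q)
  have hP : IsPoncelet c z₁ z₂ z₃ := by
    unfold IsPoncelet
    linear_combination z₁ * r - p
  refine ⟨hP, ?_⟩
  have := hP.sum_mul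
  have key : (2 * m : ℂ) = 3 - c ^ 2 := by linear_combination c * this - r
  exact_mod_cast key

/-- Three points of the circle, at mutual "distances" `uᵢⱼ = 1 - cos (sᵢ - sⱼ)`: the displacement of
`z₁` by `(u₁₂ - u₁₃) / u₂₃` times `z₂ - z₃` leads to the circle again. -/
theorem cis_add_smul_sub {s₁ s₂ s₃ : ℝ} (h : cis s₂ ≠ cis s₃) :
    cis s₁ + (((1 - Real.cos (s₁ - s₂)) - (1 - Real.cos (s₁ - s₃))) /
      (1 - Real.cos (s₂ - s₃)) : ℝ) * (cis s₂ - cis s₃) = cis (s₂ + s₃ - s₁) := by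
  have u : ∀ s t : ℝ, ((1 - Real.cos (s - t) : ℝ) : ℂ) =
      -(cis s - cis t) ^ 2 / (2 * (cis s * cis t)) := by
    intro s t
    rw [eq_div_iff (mul_ne_zero two_ne_zero (mul_ne_zero (cis_ne_zero s) (cis_ne_zero t))),
      Complex.ofReal_sub, Complex.ofReal_one]
    linear_combination (-1) * two_mul_cos_sub s t
  rw [Complex.ofReal_div, Complex.ofReal_sub, u, u, u, sub_eq_add_neg (s₂ + s₃), cis_add, cis_add,
    cis_neg]
  have := cis_ne_zero s₁
  have := cis_ne_zero s₂
  have := cis_ne_zero s₃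
  have := sub_ne_zero.2 h
  field_simp
  ring

/-! ### The 3-periodics as Poncelet triangles -/

theorem ellipsePoint_eq_iff {a b : ℝ} (ha : a ≠ 0) (hb : b ≠ 0) {s t : ℝ} :
    ellipsePoint a b s = ellipsePoint a b t ↔ cis s = cis t := by
  rw [cis_eq_cis_iff_cos_sin]
  constructor
  · intro h
    have h0 := congrArg (fun p : Plane => p 0) h
    have h1 := congrArg (fun p : Plane => p 1) h
    simpa [ellipsePoint, ha, hb] using And.intro h0 h1
  · rintro ⟨h0, h1⟩
    rw [ellipsePoint, ellipsePoint, h0, h1]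

theorem ellipsePoint_mem_ellipse {a b : ℝ} (ha : a ≠ 0) (hb : b ≠ 0) (s : ℝ) :
    ellipsePoint a b s ∈ ellipse a b := by
  simp [ellipse, ellipsePoint, ha, hb]

theorem exists_ellipsePoint_eq {a b : ℝ} (ha : a ≠ 0) (hb : b ≠ 0) {p : Plane}
    (hp : p ∈ ellipse a b) : ∃ s, p = ellipsePoint a b s := by
  refine ⟨Complex.arg ⟨p 0 / a, p 1 / b⟩, ?_⟩
  have hn : ‖(⟨p 0 / a, p 1 / b⟩ : ℂ)‖ = 1 := by
    have h : (p 0 / a) ^ 2 + (p 1 / b) ^ 2 = 1 := hp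
    rw [Complex.norm_def, Complex.normSq_mk, ← sq, ← sq, h, Real.sqrt_one]
  have h0 := Complex.norm_mul_cos_arg ⟨p 0 / a, p 1 / b⟩
  have h1 := Complex.norm_mul_sin_arg ⟨p 0 / a, p 1 / b⟩
  rw [hn, one_mul] at h0 h1
  ext i
  fin_cases i
  · simp [ellipsePoint, h0]
    field_simp
  · simp [ellipsePoint, h1]
    field_simp

theorem dist_ellipsePoint_sq (a b s t : ℝ) :
    dist (ellipsePoint a b s) (ellipsePoint a b t) ^ 2 =
      (1 - Real.cos (s - t)) * (a ^ 2 + b ^ 2 - (a ^ 2 - b ^ 2) * Real.cos (s + t)) := by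
  rw [EuclideanSpace.dist_eq, Real.sq_sqrt (by positivity), Fin.sum_univ_two, Real.dist_eq,
    Real.dist_eq, sq_abs, sq_abs, Real.cos_sub, Real.cos_add]
  simp only [ellipsePoint, Matrix.cons_val_zero, Matrix.cons_val_one]
  have hs := Real.sin_sq_add_cos_sq s
  have ht := Real.sin_sq_add_cos_sq t
  have hs' : Real.sin s ^ 2 = 1 - Real.cos s ^ 2 := by linarith
  have ht' : Real.sin t ^ 2 = 1 - Real.cos t ^ 2 := by linarith
  ring_nf
  rw [hs', ht']
  ring

theorem inner_sub_inwardNormal {a b : ℝ} (ha : a ≠ 0) (hb : b ≠ 0) (s t : ℝ) :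
    inner ℝ (ellipsePoint a b t - ellipsePoint a b s) (inwardNormal a b (ellipsePoint a b s)) =
      1 - Real.cos (s - t) := by
  rw [PiLp.inner_apply, Fin.sum_univ_two, Real.cos_sub]
  simp only [ellipsePoint, inwardNormal, PiLp.sub_apply, Matrix.cons_val_zero,
    Matrix.cons_val_one, RCLike.inner_apply, conj_trivial]
  field_simp
  linear_combination Real.sin_sq_add_cos_sq s

/-- The parameter of the Poncelet triples that correspond to the 3-periodics of the billiard with
semi-axes `a > b`. The equation says that `1 - cos (sᵢ - sⱼ)`, given by `IsPoncelet.one_sub_cos_eq`, is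
proportional to `a² + b² - (a² - b²) cos (sᵢ + sⱼ)`. -/
theorem exists_ponceletParameter {a b : ℝ} (hb : 0 < b) (hab : b < a) :
    ∃ c : ℝ, 0 < c ∧ c < 1 ∧ 2 * c * (a ^ 2 + b ^ 2) = (3 - c ^ 2) * (a ^ 2 - b ^ 2) := by
  have hD : 0 < a ^ 2 - b ^ 2 := by nlinarith
  have hf : ContinuousOn (fun c : ℝ => 2 * c * (a ^ 2 + b ^ 2) - (3 - c ^ 2) * (a ^ 2 - b ^ 2))
      (Set.Icc 0 1) := by fun_prop
  obtain ⟨c, hc, h⟩ := intermediate_value_Ioo zero_le_one hf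
    (show (0 : ℝ) ∈ _ from ⟨by nlinarith, by nlinarith⟩)
  exact ⟨c, hc.1, hc.2, sub_eq_zero.1 h⟩

/-- The reflection law makes `dist Pᵢ Pⱼ` proportional to `1 - cos (sᵢ - sⱼ)`, which is the inner
product of `Pⱼ - Pᵢ` with the normal at `Pᵢ`; this forces the angular coordinates of a 3-periodic
to form a Poncelet triple. -/
theorem IsThreePeriodic.isPoncelet {a b c : ℝ} (hb : 0 < b) (hab : b < a) (hc : 0 < c)
    (hcab : 2 * c * (a ^ 2 + b ^ 2) = (3 - c ^ 2) * (a ^ 2 - b ^ 2))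
    {T : Affine.Triangle ℝ Plane} (hT : IsThreePeriodic a b T) {s : Fin 3 → ℝ}
    (hs : ∀ i, T.points i = ellipsePoint a b (s i)) :
    IsPoncelet c (cis (s 0)) (cis (s 1)) (cis (s 2)) ∧
      ∃ r : ℝ, 0 < r ∧ ∀ i j, i ≠ j →
        dist (T.points i) (T.points j) = r * (1 - Real.cos (s i - s j)) := by
  have ha : 0 < a := hb.trans hab
  have hne : ∀ {i j}, i ≠ j → cis (s i) ≠ cis (s j) := fun {i j} hij h =>
    T.independent.injective.ne hij (by rw [hs, hs, (ellipsePoint_eq_iff ha.ne' hb.ne').2 h])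
  have hu : ∀ {i j}, i ≠ j → 0 < 1 - Real.cos (s i - s j) := fun hij =>
    sub_pos.2 (cos_sub_lt_one (hne hij))
  have hd : ∀ {i j}, i ≠ j → 0 < dist (T.points i) (T.points j) := fun hij =>
    dist_pos.2 (T.independent.injective.ne hij)
  have hsymm : ∀ i j, 1 - Real.cos (s i - s j) = 1 - Real.cos (s j - s i) := fun i j => by
    rw [← Real.cos_neg, neg_sub]
  have hlaw : ∀ i, (1 - Real.cos (s i - s (i + 1))) / dist (T.points i) (T.points (i + 1)) =
      (1 - Real.cos (s i - s (i + 2))) / dist (T.points i) (T.points (i + 2)) := by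
    intro i
    have hi1 : i ≠ i + 1 := by fin_cases i <;> simp
    have h := congrArg Real.cos (hT.reflection i)
    rw [InnerProductGeometry.cos_angle, InnerProductGeometry.cos_angle, ← dist_eq_norm,
      ← dist_eq_norm, dist_comm, dist_comm (T.points (i + 2))] at h
    simp only [hs i, hs (i + 1), hs (i + 2), inner_sub_inwardNormal ha.ne' hb.ne'] at h ⊢
    have hn : ‖inwardNormal a b (ellipsePoint a b (s i))‖ ≠ 0 := by
      intro h0
      have h1 := inner_sub_inwardNormal ha.ne' hb.ne' (s i) (s (i + 1))
      rw [norm_eq_zero.1 h0, inner_zero_right] at h1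
      exact (hu hi1).ne h1
    rw [← div_div, ← div_div] at h
    exact (div_left_inj' hn).1 h
  obtain ⟨r, hr⟩ : ∃ r, r = (1 - Real.cos (s 0 - s 1)) / dist (T.points 0) (T.points 1) := ⟨_, rfl⟩
  have hr0 : 0 < r := hr ▸ div_pos (hu (by decide)) (hd (by decide))
  have h0 := hlaw 0
  have h1 := hlaw 1
  have h2 := hlaw 2
  simp only [Fin.reduceAdd, zero_add] at h0 h1 h2
  have r02 : r = (1 - Real.cos (s 0 - s 2)) / dist (T.points 0) (T.points 2) := hr.trans h0
  have r12 : r = (1 - Real.cos (s 1 - s 2)) / dist (T.points 1) (T.points 2) := by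
    rw [h1, hr, hsymm 1 0, dist_comm (T.points 1)]
  have hall : ∀ i j, i ≠ j → 1 - Real.cos (s i - s j) = r * dist (T.points i) (T.points j) := by
    have key : ∀ i j, i < j → 1 - Real.cos (s i - s j) = r * dist (T.points i) (T.points j) := by
      intro i j hij
      rw [← div_eq_iff (hd hij.ne).ne']
      fin_cases i <;> fin_cases j <;>
        first | exact hr.symm | exact r02.symm | exact r12.symm | simp at hij
    intro i j hij
    rcases lt_or_gt_of_ne hij with h | h
    · exact key i j h
    · rw [hsymm, dist_comm, key j i h]
  have hcaustic : ∀ i j, i ≠ j → 1 - Real.cos (s i - s j) =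
      r ^ 2 * (a ^ 2 + b ^ 2) - r ^ 2 * (a ^ 2 - b ^ 2) * Real.cos (s i + s j) := by
    intro i j hij
    have hsq := dist_ellipsePoint_sq a b (s i) (s j)
    rw [← hs, ← hs] at hsq
    have hu' := hu hij
    refine mul_left_cancel₀ hu'.ne' ?_
    rw [mul_assoc (r ^ 2) (a ^ 2 - b ^ 2), ← mul_sub, mul_left_comm, ← hsq, hall i j hij]
    ring
  obtain ⟨hP, hm⟩ := isPoncelet_of_one_sub_cos_eq (hne (by decide)) (hne (by decide))
    (hne (by decide)) (hcaustic 0 1 (by decide)) (hcaustic 0 2 (by decide))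
    (hcaustic 1 2 (by decide))
  have hD : 0 < a ^ 2 - b ^ 2 := by nlinarith
  -- The quadratic equation for the parameter has a single positive root.
  have hc' : r ^ 2 * (a ^ 2 - b ^ 2) = c := by
    have hpos : 0 < (r ^ 2 * (a ^ 2 - b ^ 2) + c) * (a ^ 2 - b ^ 2) + 2 * (a ^ 2 + b ^ 2) := by
      positivity
    refine sub_eq_zero.1 (mul_left_cancel₀ hpos.ne' ?_)
    linear_combination (a ^ 2 - b ^ 2) * hm - hcab
  rw [hc'] at hP
  refine ⟨hP, r⁻¹, inv_pos.2 hr0, fun i j hij => ?_⟩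
  rw [hall i j hij]
  field_simp

theorem isThreePeriodic_of_isPoncelet {a b c : ℝ} (hb : 0 < b) (hab : b < a) (hc : 0 < c)
    (hcab : 2 * c * (a ^ 2 + b ^ 2) = (3 - c ^ 2) * (a ^ 2 - b ^ 2))
    {T : Affine.Triangle ℝ Plane} {s : Fin 3 → ℝ}
    (hs : ∀ i, T.points i = ellipsePoint a b (s i))
    (hP : IsPoncelet c (cis (s 0)) (cis (s 1)) (cis (s 2))) : IsThreePeriodic a b T := by
  have ha : 0 < a := hb.trans hab
  have hD : 0 < a ^ 2 - b ^ 2 := by nlinarith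
  have hne : ∀ {i j}, i ≠ j → cis (s i) ≠ cis (s j) := fun {i j} hij h =>
    T.independent.injective.ne hij (by rw [hs, hs, (ellipsePoint_eq_iff ha.ne' hb.ne').2 h])
  refine ⟨fun i => hs i ▸ ellipsePoint_mem_ellipse ha.ne' hb.ne' _, ?_⟩
  -- The sides are proportional to `1 - cos (sᵢ - sⱼ)`, so both sides at a vertex make with its
  -- normal `n` an angle of cosine `√(c / (a² - b²)) / ‖n‖`.
  have hside : ∀ i j, i ≠ j → (∃ u, IsPoncelet c (cis (s i)) (cis (s j)) u ∧ ∃ t, u = cis t) →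
      1 - Real.cos (s i - s j) =
        Real.sqrt (c / (a ^ 2 - b ^ 2)) * dist (T.points i) (T.points j) := by
    rintro i j hij ⟨_, h, t, rfl⟩
    have h1 := h.one_sub_cos_eq
    have hsq := dist_ellipsePoint_sq a b (s i) (s j)
    rw [← hs, ← hs] at hsq
    have hu := sub_pos.2 (cos_sub_lt_one (hne hij))
    rw [← sq_eq_sq₀ hu.le (by positivity), mul_pow, Real.sq_sqrt (by positivity), hsq]
    field_simp
    linear_combination (a ^ 2 - b ^ 2) / 2 * h1 - hcab / 2
  have hrot : ∀ i, IsPoncelet c (cis (s i)) (cis (s (i + 1))) (cis (s (i + 2))) := by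
    intro i
    fin_cases i
    exacts [hP, hP.rotate, hP.rotate.rotate]
  intro i
  have hi1 : i ≠ i + 1 := by fin_cases i <;> simp
  have hi2 : i ≠ i + 2 := by fin_cases i <;> simp
  have e1 := hside i (i + 1) hi1 ⟨_, hrot i, _, rfl⟩
  have e2 := hside i (i + 2) hi2 ⟨cis (s (i + 1)), by
    have := hrot i
    unfold IsPoncelet at *
    linear_combination this, _, rfl⟩
  have hd : ∀ {i j}, i ≠ j → dist (T.points i) (T.points j) ≠ 0 := fun hij =>
    dist_ne_zero.2 (T.independent.injective.ne hij)
  have hd1 := hd hi1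
  have hd2 := hd hi2
  rw [InnerProductGeometry.angle, InnerProductGeometry.angle, ← dist_eq_norm, ← dist_eq_norm,
    dist_comm, dist_comm (T.points (i + 2)), ← div_div, ← div_div]
  have q1 : inner ℝ (T.points (i + 1) - T.points i) (inwardNormal a b (T.points i)) =
      1 - Real.cos (s i - s (i + 1)) := by
    rw [hs, hs, inner_sub_inwardNormal ha.ne' hb.ne']
  have q2 : inner ℝ (T.points (i + 2) - T.points i) (inwardNormal a b (T.points i)) =
      1 - Real.cos (s i - s (i + 2)) := by
    rw [hs, hs, inner_sub_inwardNormal ha.ne' hb.ne']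
  rw [q1, q2, e1, e2, mul_div_cancel_right₀ _ hd1, mul_div_cancel_right₀ _ hd2]

/-- The intouchpoint of the anticomplementary triangle on the side through `Pᵢ` is the second
intersection of this side with the ellipse. -/
theorem IsThreePeriodic.actIntouchpoint_eq {a b : ℝ} (hb : 0 < b) (hab : b < a)
    {T : Affine.Triangle ℝ Plane} (hT : IsThreePeriodic a b T) {s : Fin 3 → ℝ}
    (hs : ∀ i, T.points i = ellipsePoint a b (s i)) {i j k : Fin 3}
    (hij : i ≠ j) (hik : i ≠ k) (hjk : j ≠ k) :
    actIntouchpoint T i = ellipsePoint a b (s j + s k - s i) := by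
  have ha : 0 < a := hb.trans hab
  obtain ⟨c, hc, -, hcab⟩ := exists_ponceletParameter hb hab
  obtain ⟨-, r, hr, hd⟩ := hT.isPoncelet hb hab hc hcab hs
  have hne : cis (s j) ≠ cis (s k) := fun h =>
    T.independent.injective.ne hjk (by rw [hs, hs, (ellipsePoint_eq_iff ha.ne' hb.ne').2 h])
  rw [_root_.actIntouchpoint_eq T hij hik hjk, hd i j hij, hd i k hik, hd j k hjk, ← mul_sub,
    mul_div_mul_left _ _ hr.ne']
  have h := cis_add_smul_sub (s₁ := s i) hne
  have h0 := congrArg Complex.re h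
  have h1 := congrArg Complex.im h
  simp only [Complex.add_re, Complex.re_ofReal_mul, Complex.sub_re, Complex.add_im,
    Complex.im_ofReal_mul, Complex.sub_im, cis_re, cis_im] at h0 h1
  simp only [hs]
  ext l
  fin_cases l
  · simp only [ellipsePoint, Fin.zero_eta, PiLp.add_apply, PiLp.smul_apply, PiLp.sub_apply,
      Matrix.cons_val_zero, smul_eq_mul, ← h0]
    ring
  · simp only [ellipsePoint, Fin.mk_one, PiLp.add_apply, PiLp.smul_apply, PiLp.sub_apply,
      Matrix.cons_val_one, Matrix.cons_val_fin_one, smul_eq_mul, ← h1]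
    ring

/-! ### The angular coordinate of an intouchpoint as a function of its vertex -/

/-- An argument of `(z² - c) / (z (1 - c z²))` at `z = cis s`: the angular coordinate of the
intouchpoint that belongs to a vertex with angular coordinate `s`. -/
noncomputable def intouchAngle (c s : ℝ) : ℝ :=
  s + 2 * Real.arctan (c * Real.sin (2 * s) / (1 - c * Real.cos (2 * s)))

/-- An argument of the Blaschke product `z (z² - c) / (1 - c z²)` at `z = cis s`. Modulo `2π`, it
takes the same value at the three vertices of a Poncelet triangle. -/
noncomputable def blaschkeAngle (c s : ℝ) : ℝ := intouchAngle c s + 2 * s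

theorem one_sub_mul_cos_pos {c : ℝ} (hc : 0 < c) (hc1 : c < 1) (x : ℝ) :
    0 < 1 - c * Real.cos x := by
  nlinarith [Real.cos_le_one x]

theorem one_sub_two_mul_cos_pos {c : ℝ} (hc : 0 < c) (hc1 : c < 1) (x : ℝ) :
    0 < 1 - 2 * c * Real.cos x + c ^ 2 := by
  nlinarith [Real.cos_le_one x]

theorem one_sub_mul_cis_sq_ne_zero {c : ℝ} (hc : 0 < c) (hc1 : c < 1) (s : ℝ) :
    1 - (c : ℂ) * cis s ^ 2 ≠ 0 := by
  intro h
  have h' := congrArg Complex.re h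
  rw [← cis_two_mul, Complex.sub_re, Complex.re_ofReal_mul, cis_re] at h'
  exact (one_sub_mul_cos_pos hc hc1 (2 * s)).ne' h'

theorem cis_two_mul_arctan (x : ℝ) :
    cis (2 * Real.arctan x) * (1 - x * Complex.I) = 1 + x * Complex.I := by
  have hx : 0 < 1 + x ^ 2 := by positivity
  have hx' : (1 + x ^ 2 : ℂ) ≠ 0 := by exact_mod_cast hx.ne'
  have hs : ((Real.sqrt (1 + x ^ 2) : ℝ) : ℂ) ^ 2 = 1 + x ^ 2 := by
    exact_mod_cast Real.sq_sqrt hx.le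
  rw [cis_two_mul, cis_eq, Real.cos_arctan, Real.sin_arctan]
  have hs0 : ((Real.sqrt (1 + x ^ 2) : ℝ) : ℂ) ≠ 0 := by
    exact_mod_cast (Real.sqrt_pos.2 hx).ne'
  push_cast
  field_simp
  rw [hs]
  linear_combination (-(x : ℂ) ^ 2 - x ^ 3 * Complex.I) * Complex.I_sq

theorem cis_intouchAngle {c : ℝ} (hc : 0 < c) (hc1 : c < 1) (s : ℝ) :
    cis (intouchAngle c s) * (cis s * (1 - c * cis s ^ 2)) = cis s ^ 2 - c := by
  have hN := one_sub_mul_cos_pos hc hc1 (2 * s)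
  have hN' : (1 - c * Real.cos (2 * s) : ℂ) ≠ 0 := by exact_mod_cast hN.ne'
  have h := cis_two_mul_arctan (c * Real.sin (2 * s) / (1 - c * Real.cos (2 * s)))
  have h2 := cis_eq (2 * s)
  have h3 := cis_eq (-(2 * s))
  rw [cis_two_mul] at h2
  rw [cis_neg, cis_two_mul, Real.cos_neg, Real.sin_neg] at h3
  rw [intouchAngle, cis_add]
  set w := cis (2 * Real.arctan (c * Real.sin (2 * s) / (1 - c * Real.cos (2 * s))))
  have hz := cis_ne_zero s
  rw [Complex.ofReal_div, Complex.ofReal_mul, Complex.ofReal_sub, Complex.ofReal_mul,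
    Complex.ofReal_one] at h
  have h4 : w * (1 - c * cis s ^ 2) = 1 - c * (cis s ^ 2)⁻¹ := by
    rw [h3, h2, Complex.ofReal_neg]
    generalize (Real.cos (2 * s) : ℂ) = x at *
    generalize (Real.sin (2 * s) : ℂ) = y at *
    field_simp at h
    linear_combination h
  calc cis s * w * (cis s * (1 - c * cis s ^ 2))
      = cis s ^ 2 * (w * (1 - c * cis s ^ 2)) := by ring
    _ = cis s ^ 2 - c := by rw [h4]; field_simp

theorem intouchAngle_add_two_pi (c s : ℝ) :
    intouchAngle c (s + 2 * Real.pi) = intouchAngle c s + 2 * Real.pi := by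
  have h : 2 * (s + 2 * Real.pi) = 2 * s + 2 * Real.pi + 2 * Real.pi := by ring
  simp only [intouchAngle, h, Real.cos_add_two_pi, Real.sin_add_two_pi]
  ring

theorem hasDerivAt_intouchAngle {c : ℝ} (hc : 0 < c) (hc1 : c < 1) (s : ℝ) :
    HasDerivAt (intouchAngle c) ((1 - 3 * c ^ 2 + 2 * c * Real.cos (2 * s)) /
      (1 - 2 * c * Real.cos (2 * s) + c ^ 2)) s := by
  have hN := one_sub_mul_cos_pos hc hc1 (2 * s)
  have hQ := one_sub_two_mul_cos_pos hc hc1 (2 * s)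
  have h2 : HasDerivAt (fun s : ℝ => 2 * s) 2 s := by simpa using (hasDerivAt_id s).const_mul 2
  have h := (hasDerivAt_id s).add (((((h2.sin.const_mul c).div
    ((h2.cos.const_mul c).const_sub 1) hN.ne').arctan).const_mul 2))
  refine h.congr_deriv ?_
  simp only [Pi.div_apply]
  have hsc := Real.sin_sq_add_cos_sq (2 * s)
  generalize Real.cos (2 * s) = x at *
  generalize Real.sin (2 * s) = y at *
  have hD : 1 + (c * y / (1 - c * x)) ^ 2 = (1 - 2 * c * x + c ^ 2) / (1 - c * x) ^ 2 := by
    field_simp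
    linear_combination c ^ 2 * hsc
  rw [hD]
  field_simp
  linear_combination (-4 * c ^ 2) * hsc

theorem hasDerivAt_blaschkeAngle {c : ℝ} (hc : 0 < c) (hc1 : c < 1) (s : ℝ) :
    HasDerivAt (blaschkeAngle c) ((3 - c ^ 2 - 2 * c * Real.cos (2 * s)) /
      (1 - 2 * c * Real.cos (2 * s) + c ^ 2)) s := by
  have hQ := one_sub_two_mul_cos_pos hc hc1 (2 * s)
  have h2 : HasDerivAt (fun s : ℝ => 2 * s) 2 s := by simpa using (hasDerivAt_id s).const_mul 2
  refine ((hasDerivAt_intouchAngle hc hc1 s).add h2).congr_deriv ?_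
  rw [div_add' _ _ _ hQ.ne']
  congr 1
  ring

theorem blaschkeAngle_deriv_pos {c : ℝ} (hc : 0 < c) (hc1 : c < 1) (s : ℝ) :
    0 < (3 - c ^ 2 - 2 * c * Real.cos (2 * s)) / (1 - 2 * c * Real.cos (2 * s) + c ^ 2) := by
  refine div_pos ?_ (one_sub_two_mul_cos_pos hc hc1 (2 * s))
  nlinarith [Real.cos_le_one (2 * s)]

theorem continuous_blaschkeAngle {c : ℝ} (hc : 0 < c) (hc1 : c < 1) :
    Continuous (blaschkeAngle c) :=
  continuous_iff_continuousAt.2 fun s => (hasDerivAt_blaschkeAngle hc hc1 s).continuousAt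

theorem strictMono_blaschkeAngle {c : ℝ} (hc : 0 < c) (hc1 : c < 1) :
    StrictMono (blaschkeAngle c) :=
  strictMono_of_deriv_pos fun s => by
    rw [(hasDerivAt_blaschkeAngle hc hc1 s).deriv]
    exact blaschkeAngle_deriv_pos hc hc1 s

theorem blaschkeAngle_add_two_pi (c s : ℝ) :
    blaschkeAngle c (s + 2 * Real.pi) = blaschkeAngle c s + 6 * Real.pi := by
  rw [blaschkeAngle, blaschkeAngle, intouchAngle_add_two_pi]
  ring

theorem surjective_blaschkeAngle {c : ℝ} (hc : 0 < c) (hc1 : c < 1) :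
    Function.Surjective (blaschkeAngle c) := by
  have hb : ∀ s, 3 * s - Real.pi ≤ blaschkeAngle c s ∧ blaschkeAngle c s ≤ 3 * s + Real.pi := by
    intro s
    have h1 := Real.arctan_lt_pi_div_two (c * Real.sin (2 * s) / (1 - c * Real.cos (2 * s)))
    have h2 := Real.neg_pi_div_two_lt_arctan (c * Real.sin (2 * s) / (1 - c * Real.cos (2 * s)))
    unfold blaschkeAngle intouchAngle
    constructor <;> linarith
  intro y
  have h1 := (hb ((y + Real.pi) / 3)).1
  have h2 := (hb ((y - Real.pi) / 3)).2
  have hle : (y - Real.pi) / 3 ≤ (y + Real.pi) / 3 := by linarith [Real.pi_pos]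
  obtain ⟨x, -, hx⟩ := intermediate_value_Icc hle (continuous_blaschkeAngle hc hc1).continuousOn
    (show y ∈ _ from ⟨by linarith, by linarith⟩)
  exact ⟨x, hx⟩

theorem IsPoncelet.cis_blaschkeAngle {c s₁ s₂ s₃ : ℝ} (hc : 0 < c) (hc1 : c < 1)
    (h : IsPoncelet c (cis s₁) (cis s₂) (cis s₃)) :
    cis (blaschkeAngle c s₁) = cis s₁ * cis s₂ * cis s₃ := by
  have h1 := cis_intouchAngle hc hc1 s₁
  have h2 := h.blaschke_eq
  refine mul_right_cancel₀ (one_sub_mul_cis_sq_ne_zero hc hc1 s₁) ?_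
  rw [blaschkeAngle, cis_add, cis_two_mul]
  linear_combination cis s₁ * h1 + h2

theorem IsPoncelet.cis_intouchAngle {c s₁ s₂ s₃ : ℝ} (hc : 0 < c) (hc1 : c < 1)
    (h : IsPoncelet c (cis s₁) (cis s₂) (cis s₃)) :
    cis (s₂ + s₃ - s₁) = cis (intouchAngle c s₁) := by
  have h1 := h.cis_blaschkeAngle hc hc1
  rw [blaschkeAngle, cis_add, cis_two_mul] at h1
  have hz := cis_ne_zero s₁
  rw [sub_eq_add_neg, cis_add, cis_add, cis_neg]
  field_simp
  refine mul_left_cancel₀ hz ?_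
  linear_combination -h1

theorem blaschke_eq_cis_blaschkeAngle {c : ℝ} (hc : 0 < c) (hc1 : c < 1) (s : ℝ) :
    cis s * (cis s ^ 2 - c) = cis (blaschkeAngle c s) * (1 - c * cis s ^ 2) := by
  rw [blaschkeAngle, cis_add, cis_two_mul]
  linear_combination -cis s * _root_.cis_intouchAngle hc hc1 s

/-! ### Reparametrizations of the circle -/

/-- `φ` is the lift to `ℝ` of an orientation preserving differentiable reparametrization of the
circle `ℝ / 2πℤ`, with positive derivative. -/
structure IsCircleLift (φ : ℝ → ℝ) : Prop where
  differentiable : Differentiable ℝ φ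
  deriv_pos : ∀ t, 0 < deriv φ t
  add_two_pi : ∀ t, φ (t + 2 * Real.pi) = φ t + 2 * Real.pi
  surjective : Function.Surjective φ

theorem IsCircleLift.strictMono {φ : ℝ → ℝ} (h : IsCircleLift φ) : StrictMono φ :=
  strictMono_of_deriv_pos h.deriv_pos

/-- A solution `φ` of `blaschkeAngle c (φ t) = blaschkeAngle c t + d` is a reparametrization of the
circle. For `d ∈ 2πℤ` it leads from one vertex of a Poncelet triangle to another. -/
theorem isCircleLift_of_blaschkeAngle_eq_add {c d : ℝ} (hc : 0 < c) (hc1 : c < 1) {φ : ℝ → ℝ}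
    (h : ∀ t, blaschkeAngle c (φ t) = blaschkeAngle c t + d) : IsCircleLift φ := by
  have hmono := strictMono_blaschkeAngle hc hc1
  set e := hmono.orderIsoOfSurjective _ (surjective_blaschkeAngle hc hc1)
  have hφ : φ = fun t => e.symm (blaschkeAngle c t + d) := by
    funext t
    rw [← h, OrderIso.eq_symm_apply]
    rfl
  have hcont : Continuous φ := by
    rw [hφ]
    exact e.symm.continuous.comp ((continuous_blaschkeAngle hc hc1).add continuous_const)
  have hd : ∀ t, ∃ p, 0 < p ∧ HasDerivAt φ p t := by
    intro t
    have h1 : HasDerivAt e.symm _ (blaschkeAngle c t + d) :=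
      HasDerivAt.of_local_left_inverse e.symm.continuous.continuousAt
        (hasDerivAt_blaschkeAngle hc hc1 _) (blaschkeAngle_deriv_pos hc hc1 _).ne'
        (Filter.Eventually.of_forall fun y => e.apply_symm_apply y)
    have h2 := h1.comp t ((hasDerivAt_blaschkeAngle hc hc1 t).add_const d)
    rw [hφ]
    exact ⟨_, mul_pos (inv_pos.2 (blaschkeAngle_deriv_pos hc hc1 _))
      (blaschkeAngle_deriv_pos hc hc1 _), h2⟩
  refine ⟨fun t => ?_, fun t => ?_, fun t => ?_, fun y => ?_⟩
  · obtain ⟨p, -, hp⟩ := hd t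
    exact hp.differentiableAt
  · obtain ⟨p, hp0, hp⟩ := hd t
    rwa [hp.deriv]
  · apply hmono.injective
    rw [h, blaschkeAngle_add_two_pi, blaschkeAngle_add_two_pi, h]
    ring
  · obtain ⟨t, ht⟩ := surjective_blaschkeAngle hc hc1 (blaschkeAngle c y - d)
    exact ⟨t, hmono.injective (by rw [h, ht]; ring)⟩

theorem exists_eq_const_of_forall_mem_zmultiples {g : ℝ → ℝ} (hg : Continuous g)
    (h : ∀ t, ∃ n : ℤ, g t = 2 * Real.pi * n) : ∃ n : ℤ, ∀ t, g t = 2 * Real.pi * n := by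
  choose n hn using h
  have hc : Continuous n := by
    rw [Int.isClosedEmbedding_coe_real.isEmbedding.continuous_iff]
    have : (fun t => (n t : ℝ)) = fun t => g t / (2 * Real.pi) := by
      funext t
      rw [hn]
      field_simp
    change Continuous fun t => (n t : ℝ)
    rw [this]
    exact hg.div_const _
  exact ⟨n 0, fun t => by rw [hn, PreconnectedSpace.constant inferInstance hc (x := t) (y := 0)]⟩

/-- A continuous motion on the ellipse has a continuous angular coordinate: it lifts through the
covering `Circle.exp`. -/
theorem exists_continuous_angle {a b : ℝ} (ha : a ≠ 0) (hb : b ≠ 0) {Q : ℝ → Plane}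
    (hQ : Continuous Q) (hmem : ∀ t, Q t ∈ ellipse a b) :
    ∃ φ : ℝ → ℝ, Continuous φ ∧ ∀ t, Q t = ellipsePoint a b (φ t) := by
  choose s hs using fun t => exists_ellipsePoint_eq ha hb (hmem t)
  have h0 : ∀ t, Q t 0 / a = Real.cos (s t) := fun t => by
    rw [hs t]; simp [ellipsePoint, ha]
  have h1 : ∀ t, Q t 1 / b = Real.sin (s t) := fun t => by
    rw [hs t]; simp [ellipsePoint, hb]
  have hc : Continuous fun t => Circle.exp (s t) := by
    refine Continuous.subtype_mk (f := fun t => (Circle.exp (s t) : ℂ)) ?_ _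
    have : (fun t => (Circle.exp (s t) : ℂ)) =
        fun t => ((Q t 0 / a : ℝ) : ℂ) + ((Q t 1 / b : ℝ) : ℂ) * Complex.I := by
      funext t
      rw [h0, h1, Circle.coe_exp]
      exact cis_eq (s t)
    rw [this]
    fun_prop
  obtain ⟨F, ⟨-, hF⟩, -⟩ := Circle.isCoveringMap_exp.existsUnique_continuousMap_lifts
    ⟨_, hc⟩ 0 (s 0) rfl
  refine ⟨F, F.continuous, fun t => ?_⟩
  have := congrArg (Subtype.val : Circle → ℂ) (congrFun hF t)
  rw [hs t, eq_comm, ellipsePoint_eq_iff ha hb]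
  exact this

/-! ### Families of 3-periodics -/

/-- The vertex `i` of a family of 3-periodics has an angular coordinate that is a reparametrization
of the circle, and determines the intouchpoint `i`. -/
theorem IsThreePeriodicFamily.exists_isCircleLift {a b c : ℝ} (hb : 0 < b) (hab : b < a)
    (hc : 0 < c) (hc1 : c < 1)
    (hcab : 2 * c * (a ^ 2 + b ^ 2) = (3 - c ^ 2) * (a ^ 2 - b ^ 2))
    {T : ℝ → Affine.Triangle ℝ Plane} (hT : IsThreePeriodicFamily a b T) (i : Fin 3) :
    ∃ φ : ℝ → ℝ, IsCircleLift φ ∧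
      ∀ t, actIntouchpoint (T t) i = ellipsePoint a b (intouchAngle c (φ t)) := by
  have ha : 0 < a := hb.trans hab
  choose s hscont hs using fun j : Fin 3 => exists_continuous_angle ha.ne' hb.ne'
    (hT.continuous j) (fun t => (hT.isThreePeriodic t).mem_ellipse j)
  have hP : ∀ t, IsPoncelet c (cis (s 0 t)) (cis (s 1 t)) (cis (s 2 t)) := fun t =>
    ((hT.isThreePeriodic t).isPoncelet hb hab hc hcab (s := fun j => s j t)
      (fun j => hs j t)).1
  have hrot : ∀ j t, IsPoncelet c (cis (s j t)) (cis (s (j + 1) t)) (cis (s (j + 2) t)) := by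
    intro j t
    fin_cases j
    exacts [hP t, (hP t).rotate, (hP t).rotate.rotate]
  have hprod : ∀ j t, cis (blaschkeAngle c (s j t)) = cis (s 0 t) * cis (s 1 t) * cis (s 2 t) := by
    intro j t
    rw [(hrot j t).cis_blaschkeAngle hc hc1]
    fin_cases j <;>
      simp only [Fin.reduceFinMk, Fin.reduceAdd, Fin.zero_eta, zero_add, Fin.mk_one] <;> ring
  have hlead : ∀ t, cis (s 0 t) = cis t := fun t =>
    (ellipsePoint_eq_iff ha.ne' hb.ne').1 (by rw [← hs, hT.leading])
  have hlead' : ∀ t, cis (blaschkeAngle c t) = cis (blaschkeAngle c (s 0 t)) := by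
    intro t
    refine mul_right_cancel₀ (one_sub_mul_cis_sq_ne_zero hc hc1 t) ?_
    rw [← blaschke_eq_cis_blaschkeAngle hc hc1, ← hlead, ← blaschke_eq_cis_blaschkeAngle hc hc1]
  have hcb := continuous_blaschkeAngle hc hc1
  obtain ⟨n, hn⟩ := exists_eq_const_of_forall_mem_zmultiples
    (g := fun t => blaschkeAngle c (s i t) - blaschkeAngle c t)
    ((hcb.comp (hscont i)).sub hcb) (fun t => by
      obtain ⟨n, hn⟩ := cis_eq_cis_iff.1 ((hprod i t).trans ((hlead' t).trans (hprod 0 t)).symm)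
      exact ⟨n, by rw [hn]; ring⟩)
  refine ⟨s i, isCircleLift_of_blaschkeAngle_eq_add hc hc1 (d := 2 * Real.pi * n) fun t => by
    linarith [hn t], fun t => ?_⟩
  rw [(hT.isThreePeriodic t).actIntouchpoint_eq hb hab (s := fun j => s j t) (fun j => hs j t)
    (i := i) (j := i + 1) (k := i + 2) (by fin_cases i <;> simp) (by fin_cases i <;> simp)
    (by fin_cases i <;> simp), ellipsePoint_eq_iff ha.ne' hb.ne']
  exact (hrot i t).cis_intouchAngle hc hc1

/-- Three different points of the ellipse are affinely independent. -/
theorem affineIndependent_ellipsePoint {a b : ℝ} (ha : a ≠ 0) (hb : b ≠ 0) {s : Fin 3 → ℝ}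
    (hs : Function.Injective fun i => cis (s i)) :
    AffineIndependent ℝ fun i => ellipsePoint a b (s i) := by
  have hcirc : AffineIndependent ℝ fun i => ellipsePoint 1 1 (s i) := by
    refine EuclideanGeometry.Cospherical.affineIndependent (s := ellipse 1 1) ⟨0, 1, ?_⟩ ?_ ?_
    · intro p hp
      have hp' : (p 0 / 1) ^ 2 + (p 1 / 1) ^ 2 = 1 := hp
      rw [dist_zero_right, EuclideanSpace.norm_eq, Fin.sum_univ_two, Real.norm_eq_abs,
        Real.norm_eq_abs, sq_abs, sq_abs, ← div_one (p 0), ← div_one (p 1), hp', Real.sqrt_one]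
    · rintro _ ⟨i, rfl⟩
      exact ellipsePoint_mem_ellipse one_ne_zero one_ne_zero _
    · intro i j h
      exact hs ((ellipsePoint_eq_iff one_ne_zero one_ne_zero).1 h)
  let L : Plane →ₗ[ℝ] Plane :=
    { toFun := fun p => !₂[a * p 0, b * p 1]
      map_add' := fun p q => by ext i; fin_cases i <;> simp [mul_add]
      map_smul' := fun r p => by ext i; fin_cases i <;> simp <;> ring }
  have hL : Function.Injective L.toAffineMap := by
    intro p q h
    have h0 := congrArg (fun p : Plane => p 0) h
    have h1 := congrArg (fun p : Plane => p 1) h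
    ext i
    fin_cases i
    · simpa [L, ha] using h0
    · simpa [L, hb] using h1
  have h : L.toAffineMap ∘ (fun i => ellipsePoint 1 1 (s i)) =
      fun i => ellipsePoint a b (s i) := by
    funext i
    simp [L, ellipsePoint]
  exact h ▸ hcirc.map' L.toAffineMap hL

/-- The vertices of the triangle led by `t` are found by solving
`blaschkeAngle c s = blaschkeAngle c t + 2πi`, for `i = 0, 1, 2`. -/
theorem exists_isThreePeriodicFamily {a b : ℝ} (hb : 0 < b) (hab : b < a) :
    ∃ T : ℝ → Affine.Triangle ℝ Plane, IsThreePeriodicFamily a b T := by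
  have ha : 0 < a := hb.trans hab
  obtain ⟨c, hc, hc1, hcab⟩ := exists_ponceletParameter hb hab
  have hmono := strictMono_blaschkeAngle hc hc1
  choose s hs using fun (i : Fin 3) (t : ℝ) =>
    surjective_blaschkeAngle hc hc1 (blaschkeAngle c t + 2 * Real.pi * i)
  have hs0 : ∀ t, s 0 t = t := fun t => hmono.injective (by simp [hs])
  have hsmono : ∀ t {i j : Fin 3}, i < j → s i t < s j t := by
    intro t i j hij
    rw [← hmono.lt_iff_lt, hs, hs]
    have : (i : ℝ) < j := by exact_mod_cast hij
    nlinarith [Real.pi_pos]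
  -- One turn of `s` increases `blaschkeAngle` by `6π`, so the three solutions lie within one turn.
  have hlt : ∀ t i j, s i t < s j t + 2 * Real.pi := by
    intro t i j
    rw [← hmono.lt_iff_lt, blaschkeAngle_add_two_pi, hs, hs]
    have h1 : (i : ℝ) ≤ 2 := by exact_mod_cast Fin.is_le i
    have h2 : (0 : ℝ) ≤ j := by positivity
    nlinarith [Real.pi_pos]
  have hne : ∀ t {i j : Fin 3}, i < j → cis (s i t) ≠ cis (s j t) := by
    intro t i j hij h
    obtain ⟨n, hn⟩ := cis_eq_cis_iff.1 h.symm
    have h1 := hsmono t hij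
    have h2 := hlt t j i
    rw [hn] at h1 h2
    have hn0 : (0 : ℝ) < n := by
      by_contra! hle
      nlinarith [Real.pi_pos]
    have hn1 : (n : ℝ) < 1 := by
      by_contra! hle
      nlinarith [Real.pi_pos]
    have : 0 < n := by exact_mod_cast hn0
    have : n < 1 := by exact_mod_cast hn1
    omega
  have hinj : ∀ t, Function.Injective fun i => cis (s i t) := by
    intro t i j h
    rcases lt_trichotomy i j with hij | hij | hij
    exacts [absurd h (hne t hij), hij, absurd h.symm (hne t hij)]
  have hP : ∀ t, IsPoncelet c (cis (s 0 t)) (cis (s 1 t)) (cis (s 2 t)) := by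
    intro t
    have hroot : ∀ i, cis (s i t) * (cis (s i t) ^ 2 - c) =
        cis (blaschkeAngle c t) * (1 - c * cis (s i t) ^ 2) := by
      intro i
      rw [blaschke_eq_cis_blaschkeAngle hc hc1, hs]
      congr 1
      exact cis_eq_cis_iff.2 ⟨i, by push_cast; ring⟩
    exact isPoncelet_of_blaschke_eq (hne t (by decide)) (hne t (by decide)) (hne t (by decide))
      (hroot 0) (hroot 1) (hroot 2)
  refine ⟨fun t => ⟨fun i => ellipsePoint a b (s i t),
    affineIndependent_ellipsePoint ha.ne' hb.ne' (hinj t)⟩, fun t => ?_, fun t => ?_, fun i => ?_⟩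
  · exact isThreePeriodic_of_isPoncelet hb hab hc hcab (s := fun i => s i t) (fun i => rfl) (hP t)
  · change ellipsePoint a b (s 0 t) = _
    rw [hs0]
  · have : Continuous (s i) :=
      (isCircleLift_of_blaschkeAngle_eq_add hc hc1 (hs i)).differentiable.continuous
    unfold ellipsePoint
    fun_prop

/-! ### The velocity of an intouchpoint -/

/-- The sign of the velocity `dθ/ds` of the intouchpoint, `s` being the angular coordinate of its
vertex and `θ = intouchAngle c s`, is that of `(1 - 3c)(1 + c) + 4c cos² s`. -/
theorem exists_hasDerivAt_intouchAngle {c : ℝ} (hc : 0 < c) (hc1 : c < 1) (s : ℝ) :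
    ∃ q : ℝ, 0 < q ∧ HasDerivAt (intouchAngle c)
      (q * ((1 - 3 * c) * (1 + c) + 4 * c * Real.cos s ^ 2)) s := by
  have hQ := one_sub_two_mul_cos_pos hc hc1 (2 * s)
  refine ⟨(1 - 2 * c * Real.cos (2 * s) + c ^ 2)⁻¹, inv_pos.2 hQ,
    (hasDerivAt_intouchAngle hc hc1 s).congr_deriv ?_⟩
  rw [div_eq_inv_mul]
  congr 1
  rw [Real.cos_two_mul]
  ring

theorem exists_deriv_intouchAngle_comp {c : ℝ} (hc : 0 < c) (hc1 : c < 1) {φ : ℝ → ℝ}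
    (hφ : IsCircleLift φ) (t : ℝ) :
    ∃ q : ℝ, 0 < q ∧ HasDerivAt (fun t => intouchAngle c (φ t))
      (q * ((1 - 3 * c) * (1 + c) + 4 * c * Real.cos (φ t) ^ 2)) t := by
  obtain ⟨q, hq, h⟩ := exists_hasDerivAt_intouchAngle hc hc1 (φ t)
  refine ⟨q * deriv φ t, mul_pos hq (hφ.deriv_pos t),
    (h.comp t (hφ.differentiable t).hasDerivAt).congr_deriv ?_⟩
  ring

theorem deriv_intouchAngle_comp_pos_iff {c : ℝ} (hc : 0 < c) (hc1 : c < 1) {φ : ℝ → ℝ}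
    (hφ : IsCircleLift φ) (t : ℝ) :
    0 < deriv (fun t => intouchAngle c (φ t)) t ↔
      0 < (1 - 3 * c) * (1 + c) + 4 * c * Real.cos (φ t) ^ 2 := by
  obtain ⟨q, hq, h⟩ := exists_deriv_intouchAngle_comp hc hc1 hφ t
  rw [h.deriv, mul_pos_iff_of_pos_left hq]

theorem deriv_intouchAngle_comp_neg_iff {c : ℝ} (hc : 0 < c) (hc1 : c < 1) {φ : ℝ → ℝ}
    (hφ : IsCircleLift φ) (t : ℝ) :
    deriv (fun t => intouchAngle c (φ t)) t < 0 ↔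
      (1 - 3 * c) * (1 + c) + 4 * c * Real.cos (φ t) ^ 2 < 0 := by
  obtain ⟨q, hq, h⟩ := exists_deriv_intouchAngle_comp hc hc1 hφ t
  rw [h.deriv, ← smul_eq_mul, smul_neg_iff_of_pos_left hq]

theorem deriv_intouchAngle_comp_eq_zero_iff {c : ℝ} (hc : 0 < c) (hc1 : c < 1) {φ : ℝ → ℝ}
    (hφ : IsCircleLift φ) (t : ℝ) :
    deriv (fun t => intouchAngle c (φ t)) t = 0 ↔
      (1 - 3 * c) * (1 + c) + 4 * c * Real.cos (φ t) ^ 2 = 0 := by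
  obtain ⟨q, hq, h⟩ := exists_deriv_intouchAngle_comp hc hc1 hφ t
  rw [h.deriv, mul_eq_zero_iff_left hq.ne']

/-- The position of the intouchpoint at the instants when it stands still. At these instants
`(z² - c) / (z (1 - c z²)) = (z - 3c z⁻¹) / 2`. -/
theorem cos_sin_intouchAngle_of_stop {c s : ℝ} (hc : 0 < c) (hc1 : c < 1)
    (h : (1 - 3 * c) * (1 + c) + 4 * c * Real.cos s ^ 2 = 0) :
    Real.cos (intouchAngle c s) = (1 - 3 * c) / 2 * Real.cos s ∧
      Real.sin (intouchAngle c s) = (1 + 3 * c) / 2 * Real.sin s := by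
  have hz := cis_ne_zero s
  have h1 := cis_intouchAngle hc hc1 s
  have h2 := two_mul_cos_add s s
  rw [← two_mul, Real.cos_two_mul] at h2
  have hC : ((1 - 3 * c) * (1 + c) + 4 * c * (Real.cos s : ℂ) ^ 2 : ℂ) = 0 := by exact_mod_cast h
  have hcis : cis (intouchAngle c s) = (cis s - 3 * c * (cis s)⁻¹) / 2 := by
    refine mul_right_cancel₀ (mul_ne_zero hz (one_sub_mul_cis_sq_ne_zero hc hc1 s)) ?_
    rw [h1]
    field_simp
    push_cast at h2 hC
    linear_combination cis s ^ 2 * hC - c * h2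
  rw [← cis_neg, cis_eq s, cis_eq (-s), Real.cos_neg, Real.sin_neg] at hcis
  have e : cis (intouchAngle c s) = (((1 - 3 * c) / 2 * Real.cos s : ℝ) : ℂ) +
      (((1 + 3 * c) / 2 * Real.sin s : ℝ) : ℂ) * Complex.I := by
    rw [hcis]
    push_cast
    ring
  constructor
  · rw [← cis_re, e]
    simp [-Complex.ofReal_mul, -Complex.ofReal_cos, -Complex.ofReal_sin]
  · rw [← cis_im, e]
    simp [-Complex.ofReal_mul, -Complex.ofReal_cos, -Complex.ofReal_sin]

theorem ellipsePoint_intouchAngle_top (a b c : ℝ) :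
    ellipsePoint a b (intouchAngle c (Real.pi / 2)) = topVertex b := by
  have h : 2 * (Real.pi / 2) = Real.pi := by ring
  simp [intouchAngle, ellipsePoint, topVertex, h]

theorem ellipsePoint_intouchAngle_bottom (a b c : ℝ) :
    ellipsePoint a b (intouchAngle c (Real.pi / 2 + Real.pi)) = bottomVertex b := by
  have h : 2 * (Real.pi / 2 + Real.pi) = Real.pi + 2 * Real.pi := by ring
  simp [intouchAngle, ellipsePoint, bottomVertex, h, Real.cos_add_pi, Real.sin_add_pi]

/-! ### The three regimes -/

theorem movesForward_intouchAngle_comp {c : ℝ} (hc : 0 < c) (hc3 : c < 1 / 3) {φ : ℝ → ℝ}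
    (hφ : IsCircleLift φ) : MovesForward fun t => intouchAngle c (φ t) := by
  have hpos : ∀ t, 0 < deriv (fun t => intouchAngle c (φ t)) t := fun t =>
    (deriv_intouchAngle_comp_pos_iff hc (by linarith) hφ t).2
      (add_pos_of_pos_of_nonneg (mul_pos (by linarith) (by linarith)) (by positivity))
  exact ⟨strictMono_of_deriv_pos hpos, hpos⟩

/-- The cosine has no interval of zeros. -/
theorem exists_mem_Ioo_cos_ne_zero {x y : ℝ} (h : x < y) : ∃ s ∈ Set.Ioo x y, Real.cos s ≠ 0 := by
  by_contra! h0
  obtain ⟨d, hd⟩ : ∃ d, d = min ((y - x) / 3) 1 := ⟨_, rfl⟩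
  have hd0 : 0 < d := hd ▸ lt_min (by linarith) one_pos
  have hd1 : d ≤ (y - x) / 3 := hd ▸ min_le_left _ _
  have hd2 : d ≤ 1 := hd ▸ min_le_right _ _
  have h1 := h0 (x + d) ⟨by linarith, by linarith⟩
  have h2 := h0 (x + d + d) ⟨by linarith, by linarith⟩
  have hs : 0 < Real.sin d := Real.sin_pos_of_pos_of_lt_pi hd0 (by linarith [Real.pi_gt_three])
  rw [Real.cos_add, h1, zero_mul, zero_sub, neg_eq_zero, mul_eq_zero] at h2
  have h3 := Real.sin_sq_add_cos_sq (x + d)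
  rcases h2 with h2 | h2
  · rw [h1, h2] at h3
    norm_num at h3
  · exact hs.ne' h2

/-- At the threshold `c = 1/3` the derivative vanishes only at the zeros of the cosine. -/
theorem strictMono_intouchAngle_third : StrictMono (intouchAngle (1 / 3)) := by
  have hd := fun s => exists_hasDerivAt_intouchAngle (c := 1 / 3) (by norm_num) (by norm_num) s
  choose q hq hd using hd
  have hmono : Monotone (intouchAngle (1 / 3)) :=
    monotone_of_deriv_nonneg (fun s => (hd s).differentiableAt) fun s => by
      rw [(hd s).deriv]
      exact mul_nonneg (hq s).le (by norm_num; positivity)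
  refine hmono.strictMono_of_injective (.of_lt_imp_ne fun x y hxy heq => ?_)
  obtain ⟨s, hs, hcos⟩ := exists_mem_Ioo_cos_ne_zero hxy
  have hconst : intouchAngle (1 / 3) =ᶠ[nhds s] fun _ => intouchAngle (1 / 3) x := by
    filter_upwards [Ioo_mem_nhds hs.1 hs.2] with u hu
    exact le_antisymm ((hmono hu.2.le).trans heq.ge) (hmono hu.1.le)
  have h0 := (hd s).unique ((hasDerivAt_const s _).congr_of_eventuallyEq hconst)
  have : 0 < Real.cos s ^ 2 := by positivity
  have : 0 < q s * ((1 - 3 * (1 / 3)) * (1 + 1 / 3) + 4 * (1 / 3) * Real.cos s ^ 2) :=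
    mul_pos (hq s) (by linarith)
  exact this.ne' h0

theorem movesForwardWithTwoStops_intouchAngle_comp {a b : ℝ} {φ : ℝ → ℝ} (hφ : IsCircleLift φ)
    {Q : ℝ → Plane} (hQ : ∀ t, Q t = ellipsePoint a b (intouchAngle (1 / 3) (φ t))) :
    MovesForwardWithTwoStops b Q fun t => intouchAngle (1 / 3) (φ t) := by
  have hpi := Real.pi_pos
  have hpos := deriv_intouchAngle_comp_pos_iff (c := 1 / 3) (by norm_num) (by norm_num) hφ
  have hzero := deriv_intouchAngle_comp_eq_zero_iff (c := 1 / 3) (by norm_num) (by norm_num) hφ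
  obtain ⟨t₁, h₁⟩ := hφ.surjective (Real.pi / 2)
  obtain ⟨t₂, h₂⟩ := hφ.surjective (Real.pi / 2 + Real.pi)
  refine ⟨strictMono_intouchAngle_third.comp hφ.strictMono, t₁, t₂, ?_, ?_, ?_, ?_, ?_, ?_, ?_, ?_⟩
  · rw [← hφ.strictMono.lt_iff_lt, h₁, h₂]
    linarith
  · rw [← hφ.strictMono.lt_iff_lt, hφ.add_two_pi, h₁, h₂]
    linarith
  · rw [hQ, h₁, ellipsePoint_intouchAngle_top]
  · rw [hzero, h₁, Real.cos_pi_div_two]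
    norm_num
  · rw [hQ, h₂, ellipsePoint_intouchAngle_bottom]
  · rw [hzero, h₂, Real.cos_add_pi, Real.cos_pi_div_two]
    norm_num
  · intro t ht
    have hl := hφ.strictMono ht.1
    have hr := hφ.strictMono ht.2
    rw [h₁] at hl
    rw [h₂] at hr
    have hcos := (Real.cos_neg_of_pi_div_two_lt_of_lt hl (by linarith)).ne
    rw [hpos]
    norm_num
    positivity
  · intro t ht
    have hl := hφ.strictMono ht.1
    have hr := hφ.strictMono ht.2
    rw [h₂] at hl
    rw [hφ.add_two_pi, h₁] at hr
    have hcos : Real.cos (φ t) ≠ 0 := by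
      rw [← Real.cos_sub_two_pi]
      exact (Real.cos_pos_of_mem_Ioo ⟨by linarith, by linarith⟩).ne'
    rw [hpos]
    norm_num
    positivity

theorem movesWithFourReversals_intouchAngle_comp {a b c : ℝ} (ha : 0 < a) (hb : 0 < b)
    (hc3 : 1 / 3 < c) (hc1 : c < 1) {φ : ℝ → ℝ} (hφ : IsCircleLift φ)
    {Q : ℝ → Plane} (hQ : ∀ t, Q t = ellipsePoint a b (intouchAngle c (φ t))) :
    MovesWithFourReversals b Q fun t => intouchAngle c (φ t) := by
  have hpi := Real.pi_pos
  have hc : 0 < c := by linarith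
  have hneg := deriv_intouchAngle_comp_neg_iff hc hc1 hφ
  have hpos := deriv_intouchAngle_comp_pos_iff hc hc1 hφ
  have hzero := deriv_intouchAngle_comp_eq_zero_iff hc hc1 hφ
  -- The velocity vanishes where `cos² s = m²`, that is at `δ`, `π - δ`, `π + δ`, `2π - δ`.
  obtain ⟨m, hm0, hm1, hm⟩ : ∃ m : ℝ, 0 < m ∧ m < 1 ∧
      (1 - 3 * c) * (1 + c) + 4 * c * m ^ 2 = 0 := by
    have h0 : 0 < (3 * c - 1) * (1 + c) / (4 * c) :=
      div_pos (mul_pos (by linarith) (by linarith)) (by linarith)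
    refine ⟨Real.sqrt ((3 * c - 1) * (1 + c) / (4 * c)), Real.sqrt_pos.2 h0, ?_, ?_⟩
    · rw [Real.sqrt_lt' one_pos, div_lt_iff₀ (by linarith)]
      nlinarith
    · rw [Real.sq_sqrt h0.le]
      field_simp
      ring
  have hsign : ∀ x, (1 - 3 * c) * (1 + c) + 4 * c * x ^ 2 = 4 * c * (x ^ 2 - m ^ 2) := fun x => by
    linear_combination hm
  simp only [hsign] at hneg hpos hzero
  obtain ⟨δ, hδ⟩ : ∃ δ, δ = Real.arccos m := ⟨_, rfl⟩
  have hδ0 : 0 < δ := hδ ▸ Real.arccos_pos.2 hm1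
  have hδ1 : δ < Real.pi / 2 := hδ ▸ Real.arccos_lt_pi_div_two.2 hm0
  have hcosδ : Real.cos δ = m := hδ ▸ Real.cos_arccos (by linarith) hm1.le
  have hsinδ : 0 < Real.sin δ := Real.sin_pos_of_pos_of_lt_pi hδ0 (by linarith)
  have hin : ∀ x, -δ < x → x < δ → 0 < 4 * c * (Real.cos x ^ 2 - m ^ 2) := by
    intro x h1 h2
    have : m < Real.cos x := by
      rw [← hcosδ, ← Real.cos_abs x]
      exact Real.cos_lt_cos_of_nonneg_of_le_pi (abs_nonneg x) (by linarith) (abs_lt.2 ⟨h1, h2⟩)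
    exact mul_pos (by linarith) (by nlinarith)
  have hout : ∀ x, δ < x → x < Real.pi - δ → 4 * c * (Real.cos x ^ 2 - m ^ 2) < 0 := by
    intro x h1 h2
    have e1 : Real.cos x < m := hcosδ ▸ Real.cos_lt_cos_of_nonneg_of_le_pi hδ0.le (by linarith) h1
    have e2 : -m < Real.cos x := by
      rw [← hcosδ, ← Real.cos_pi_sub]
      exact Real.cos_lt_cos_of_nonneg_of_le_pi (by linarith) (by linarith) h2
    exact mul_neg_of_pos_of_neg (by linarith) (by nlinarith)
  have hper : ∀ x, Real.cos x ^ 2 = Real.cos (x - Real.pi) ^ 2 := fun x => by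
    rw [Real.cos_sub_pi, neg_sq]
  obtain ⟨t₁, h₁⟩ := hφ.surjective δ
  obtain ⟨t₂, h₂⟩ := hφ.surjective (Real.pi - δ)
  obtain ⟨t₃, h₃⟩ := hφ.surjective (Real.pi + δ)
  obtain ⟨t₄, h₄⟩ := hφ.surjective (2 * Real.pi - δ)
  obtain ⟨u, hu⟩ := hφ.surjective (Real.pi / 2)
  obtain ⟨v, hv⟩ := hφ.surjective (Real.pi / 2 + Real.pi)
  have hlt := fun {x y} => hφ.strictMono.lt_iff_lt (a := x) (b := y)
  have c₁ : Real.cos (φ t₁) = m := by rw [h₁, hcosδ]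
  have c₂ : Real.cos (φ t₂) = -m := by rw [h₂, Real.cos_pi_sub, hcosδ]
  have c₃ : Real.cos (φ t₃) = -m := by rw [h₃, add_comm, Real.cos_add_pi, hcosδ]
  have c₄ : Real.cos (φ t₄) = m := by rw [h₄, Real.cos_two_pi_sub, hcosδ]
  have s₁ : Real.sin (φ t₁) = Real.sin δ := by rw [h₁]
  have s₂ : Real.sin (φ t₂) = Real.sin δ := by rw [h₂, Real.sin_pi_sub]
  have s₃ : Real.sin (φ t₃) = -Real.sin δ := by rw [h₃, add_comm, Real.sin_add_pi]
  have s₄ : Real.sin (φ t₄) = -Real.sin δ := by rw [h₄, Real.sin_two_pi_sub]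
  have t₁₂ : ∀ t ∈ Set.Ioo t₁ t₂, deriv (fun t => intouchAngle c (φ t)) t < 0 := by
    rintro t ⟨hl, hr⟩
    rw [← hlt, h₁] at hl
    rw [← hlt, h₂] at hr
    exact (hneg t).2 (hout _ hl hr)
  have h12 : t₁ < t₂ := by rw [← hlt, h₁, h₂]; linarith
  -- The coordinates of the intouchpoint at a stop, from the cosine and sine of its vertex.
  have hpos0 : ∀ t, Real.cos (φ t) ^ 2 = m ^ 2 →
      Q t 0 = a * ((1 - 3 * c) / 2 * Real.cos (φ t)) ∧
      Q t 1 = b * ((1 + 3 * c) / 2 * Real.sin (φ t)) := by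
    intro t ht
    obtain ⟨e1, e2⟩ := cos_sin_intouchAngle_of_stop hc hc1 (s := φ t) (by rw [ht, hm])
    rw [← e1, ← e2, hQ]
    simp [ellipsePoint]
  have hx : a * ((3 * c - 1) / 2 * m) > 0 := by
    have : 0 < 3 * c - 1 := by linarith
    positivity
  have hy : b * ((1 + 3 * c) / 2 * Real.sin δ) > 0 := by positivity
  refine ⟨fun hmono => ?_, t₁, t₂, t₃, t₄, h12, ?_, ?_, ?_, ?_, ?_, ?_, ?_, t₁₂, ?_, ?_, ?_, ?_, ?_,
    ⟨u, ⟨?_, ?_⟩, ?_⟩, ?_, ?_, ⟨v, ⟨?_, ?_⟩, ?_⟩⟩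
  · exact absurd (hmono.deriv_nonneg (x := (t₁ + t₂) / 2))
      (not_le.2 (t₁₂ _ ⟨by linarith, by linarith⟩))
  · rw [← hlt, h₂, h₃]; linarith
  · rw [← hlt, h₃, h₄]; linarith
  · rw [← hlt, hφ.add_two_pi, h₄, h₁]; linarith
  · rw [hzero, c₁, sub_self, mul_zero]
  · rw [hzero, c₂, neg_sq, sub_self, mul_zero]
  · rw [hzero, c₃, neg_sq, sub_self, mul_zero]
  · rw [hzero, c₄, sub_self, mul_zero]
  · rintro t ⟨hl, hr⟩
    rw [← hlt, h₂] at hl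
    rw [← hlt, h₃] at hr
    rw [hpos, hper]
    exact hin _ (by linarith) (by linarith)
  · rintro t ⟨hl, hr⟩
    rw [← hlt, h₃] at hl
    rw [← hlt, h₄] at hr
    rw [hneg, hper]
    exact hout _ (by linarith) (by linarith)
  · rintro t ⟨hl, hr⟩
    rw [← hlt, h₄] at hl
    rw [← hlt, hφ.add_two_pi, h₁] at hr
    rw [hpos, ← Real.cos_sub_two_pi]
    exact hin _ (by linarith) (by linarith)
  · obtain ⟨e1, e2⟩ := hpos0 t₁ (by rw [c₁])
    rw [e1, e2, c₁, s₁]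
    constructor <;> linarith
  · obtain ⟨e1, e2⟩ := hpos0 t₂ (by rw [c₂, neg_sq])
    rw [e1, e2, c₂, s₂]
    constructor <;> linarith
  · rw [← hlt, h₁, hu]; linarith
  · rw [← hlt, h₂, hu]; linarith
  · rw [hQ, hu, ellipsePoint_intouchAngle_top]
  · obtain ⟨e1, e2⟩ := hpos0 t₃ (by rw [c₃, neg_sq])
    rw [e1, e2, c₃, s₃]
    constructor <;> linarith
  · obtain ⟨e1, e2⟩ := hpos0 t₄ (by rw [c₄])
    rw [e1, e2, c₄, s₄]
    constructor <;> linarith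
  · rw [← hlt, h₃, hv]; linarith
  · rw [← hlt, h₄, hv]; linarith
  · rw [hQ, hv, ellipsePoint_intouchAngle_bottom]

/-! ### The threshold and the neighbourhood of the top and bottom vertices -/

theorem alphaAct_sq : alphaAct ^ 2 = 8 / 5 := by
  rw [alphaAct, mul_pow, Real.sq_sqrt (by norm_num)]
  norm_num

theorem alphaAct_pos : 0 < alphaAct := by
  unfold alphaAct
  positivity

/-- The relation between the parameter `c` and the aspect ratio; the threshold is `c = 1/3`. -/
theorem ponceletParameter_threshold {a b c : ℝ} (hb : 0 < b)
    (hcab : 2 * c * (a ^ 2 + b ^ 2) = (3 - c ^ 2) * (a ^ 2 - b ^ 2)) :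
    5 * ((3 + c) * (1 - c)) * ((a / b) ^ 2 - alphaAct ^ 2) = (3 * c - 1) * (c + 9) := by
  rw [alphaAct_sq]
  field_simp
  linear_combination (-5) * hcab

theorem lt_alphaAct_iff {a b c : ℝ} (ha : 0 < a) (hb : 0 < b) (hc : 0 < c) (hc1 : c < 1)
    (hcab : 2 * c * (a ^ 2 + b ^ 2) = (3 - c ^ 2) * (a ^ 2 - b ^ 2)) :
    a / b < alphaAct ↔ c < 1 / 3 := by
  have h := ponceletParameter_threshold hb hcab
  have h1 : 0 < 5 * ((3 + c) * (1 - c)) := by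
    have : 0 < 1 - c := by linarith
    positivity
  rw [← sq_lt_sq₀ (by positivity) alphaAct_pos.le, ← sub_neg,
    ← smul_neg_iff_of_pos_left h1, smul_eq_mul, h, mul_comm, ← smul_eq_mul,
    smul_neg_iff_of_pos_left (by linarith)]
  constructor <;> intro h <;> linarith

theorem alphaAct_lt_iff {a b c : ℝ} (ha : 0 < a) (hb : 0 < b) (hc : 0 < c) (hc1 : c < 1)
    (hcab : 2 * c * (a ^ 2 + b ^ 2) = (3 - c ^ 2) * (a ^ 2 - b ^ 2)) :
    alphaAct < a / b ↔ 1 / 3 < c := by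
  have h := ponceletParameter_threshold hb hcab
  have h1 : 0 < 5 * ((3 + c) * (1 - c)) := by
    have : 0 < 1 - c := by linarith
    positivity
  rw [← sq_lt_sq₀ alphaAct_pos.le (by positivity), ← sub_pos,
    ← mul_pos_iff_of_pos_left h1, h, mul_pos_iff_of_pos_right (by linarith)]
  constructor <;> intro h <;> linarith

theorem eq_alphaAct_iff {a b c : ℝ} (ha : 0 < a) (hb : 0 < b) (hc : 0 < c) (hc1 : c < 1)
    (hcab : 2 * c * (a ^ 2 + b ^ 2) = (3 - c ^ 2) * (a ^ 2 - b ^ 2)) :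
    a / b = alphaAct ↔ c = 1 / 3 := by
  have h1 := lt_alphaAct_iff ha hb hc hc1 hcab
  have h2 := alphaAct_lt_iff ha hb hc hc1 hcab
  rw [eq_iff_le_not_lt, eq_iff_le_not_lt, h1, ← not_lt, h2, not_lt]

/-- Angular coordinates of the same motion have the same derivative. -/
theorem IsAngularCoordinate.deriv_eq {a b : ℝ} (ha : a ≠ 0) (hb : b ≠ 0) {Q : ℝ → Plane}
    {θ₁ θ₂ : ℝ → ℝ} (h₁ : IsAngularCoordinate a b Q θ₁) (h₂ : IsAngularCoordinate a b Q θ₂) :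
    deriv θ₁ = deriv θ₂ := by
  obtain ⟨n, hn⟩ := exists_eq_const_of_forall_mem_zmultiples
    (h₁.differentiable.continuous.sub h₂.differentiable.continuous) fun t => by
      obtain ⟨n, hn⟩ := cis_eq_cis_iff.1 ((ellipsePoint_eq_iff ha hb).1
        ((h₁.eq_point t).symm.trans (h₂.eq_point t)))
      exact ⟨n, by rw [Pi.sub_apply, hn]; ring⟩
  have : θ₁ = fun t => θ₂ t + 2 * Real.pi * n := by
    funext t
    linarith [hn t, Pi.sub_apply θ₁ θ₂ t]
  funext t
  rw [this, deriv_add_const]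

theorem dist_vertex_lt {a b s r : ℝ} (hr : 0 < r)
    (h : (a ^ 2 + b ^ 2) * Real.cos s ^ 2 < r ^ 2) :
    dist (ellipsePoint a b s) (topVertex b) < r ∨
      dist (ellipsePoint a b s) (bottomVertex b) < r := by
  have hsc := Real.sin_sq_add_cos_sq s
  have h1 := Real.sin_le_one s
  have h2 := Real.neg_one_le_sin s
  rcases le_total 0 (Real.sin s) with h0 | h0
  · left
    rw [← sq_lt_sq₀ dist_nonneg hr.le, EuclideanSpace.dist_eq, Real.sq_sqrt (by positivity),
      Fin.sum_univ_two, Real.dist_eq, Real.dist_eq, sq_abs, sq_abs]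
    simp only [ellipsePoint, topVertex, Matrix.cons_val_zero, Matrix.cons_val_one,
      Matrix.cons_val_fin_one]
    have : (1 - Real.sin s) ^ 2 ≤ Real.cos s ^ 2 := by nlinarith
    nlinarith [mul_le_mul_of_nonneg_left this (sq_nonneg b)]
  · right
    rw [← sq_lt_sq₀ dist_nonneg hr.le, EuclideanSpace.dist_eq, Real.sq_sqrt (by positivity),
      Fin.sum_univ_two, Real.dist_eq, Real.dist_eq, sq_abs, sq_abs]
    simp only [ellipsePoint, bottomVertex, Matrix.cons_val_zero, Matrix.cons_val_one,
      Matrix.cons_val_fin_one]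
    have : (1 + Real.sin s) ^ 2 ≤ Real.cos s ^ 2 := by nlinarith
    nlinarith [mul_le_mul_of_nonneg_left this (sq_nonneg b)]

/-- The stops of an intouchpoint approach the line `x = 0` as the aspect ratio decreases to the
threshold: both `cos² s` and `(a / b)² - 8/5` are of the order of `3c - 1`. -/
theorem cos_sq_intouchAngle_le_of_stop {a b c s : ℝ} (hb : 0 < b) (hc3 : 1 / 3 < c) (hc1 : c < 1)
    (hcab : 2 * c * (a ^ 2 + b ^ 2) = (3 - c ^ 2) * (a ^ 2 - b ^ 2))
    (h : (1 - 3 * c) * (1 + c) + 4 * c * Real.cos s ^ 2 = 0) :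
    Real.cos (intouchAngle c s) ^ 2 ≤ 2 * ((a / b) ^ 2 - alphaAct ^ 2) := by
  have h1 := ponceletParameter_threshold hb hcab
  rw [(cos_sin_intouchAngle_of_stop (by linarith) hc1 h).1]
  set X := (a / b) ^ 2 - alphaAct ^ 2
  have hk : 0 < 5 * ((3 + c) * (1 - c)) := by nlinarith
  have hX0 : 0 < X := by
    rw [← mul_pos_iff_of_pos_left hk, h1]
    exact mul_pos (by linarith) (by linarith)
  have hX : 3 * c - 1 ≤ 2 * X := by
    have h2 : 5 * ((3 + c) * (1 - c)) * X ≤ 18 * X :=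
      mul_le_mul_of_nonneg_right (by nlinarith) hX0.le
    nlinarith
  have hcos : Real.cos s ^ 2 ≤ 3 * c - 1 := by nlinarith
  have : ((1 - 3 * c) / 2) ^ 2 ≤ 1 := by nlinarith
  rw [mul_pow]
  nlinarith [sq_nonneg (Real.cos s)]

/-! ### The motion of the intouchpoints -/

theorem mainTheorem3 :
    (∀ a b : ℝ, 0 < b → b < a →
      (∃ T : ℝ → Affine.Triangle ℝ Plane, IsThreePeriodicFamily a b T) ∧
      ∀ T : ℝ → Affine.Triangle ℝ Plane, IsThreePeriodicFamily a b T →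
        ∀ i : Fin 3, ∃ θ : ℝ → ℝ,
          IsAngularCoordinate a b (fun t => actIntouchpoint (T t) i) θ ∧
          (∀ t, θ (t + 2 * Real.pi) = θ t + 2 * Real.pi) ∧
          (a / b < alphaAct → MovesForward θ) ∧
          (a / b = alphaAct →
            MovesForwardWithTwoStops b (fun t => actIntouchpoint (T t) i) θ) ∧
          (alphaAct < a / b →
            MovesWithFourReversals b (fun t => actIntouchpoint (T t) i) θ)) ∧
    -- the reversals take place near the top and bottom vertices: they tend to these vertices,
    -- at the scale of the ellipse, as the aspect ratio decreases to the threshold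
    (∀ ε : ℝ, 0 < ε → ∃ η : ℝ, 0 < η ∧ ∀ a b : ℝ, 0 < b →
      alphaAct < a / b → a / b < alphaAct + η →
      ∀ T : ℝ → Affine.Triangle ℝ Plane, IsThreePeriodicFamily a b T →
        ∀ (i : Fin 3) (θ : ℝ → ℝ),
          IsAngularCoordinate a b (fun t => actIntouchpoint (T t) i) θ →
          ∀ t, deriv θ t = 0 →
            dist (actIntouchpoint (T t) i) (topVertex b) < ε * b ∨
            dist (actIntouchpoint (T t) i) (bottomVertex b) < ε * b) := by
  have hcoord : ∀ {a b c : ℝ}, 0 < c → c < 1 → ∀ {T : ℝ → Affine.Triangle ℝ Plane} {i : Fin 3}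
      {φ : ℝ → ℝ}, IsCircleLift φ →
      (∀ t, actIntouchpoint (T t) i = ellipsePoint a b (intouchAngle c (φ t))) →
      IsAngularCoordinate a b (fun t => actIntouchpoint (T t) i) fun t => intouchAngle c (φ t) := by
    intro a b c hc hc1 T i φ hφ hpt
    refine ⟨fun t => ?_, hpt⟩
    obtain ⟨q, -, h⟩ := exists_deriv_intouchAngle_comp hc hc1 hφ t
    exact h.differentiableAt
  refine ⟨fun a b hb hab => ⟨exists_isThreePeriodicFamily hb hab, fun T hT i => ?_⟩, ?_⟩
  · have ha : 0 < a := hb.trans hab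
    obtain ⟨c, hc, hc1, hcab⟩ := exists_ponceletParameter hb hab
    obtain ⟨φ, hφ, hpt⟩ := hT.exists_isCircleLift hb hab hc hc1 hcab i
    refine ⟨fun t => intouchAngle c (φ t), hcoord hc hc1 hφ hpt, fun t => ?_, fun h => ?_,
      fun h => ?_, fun h => ?_⟩
    · simp only [hφ.add_two_pi, intouchAngle_add_two_pi]
    · exact movesForward_intouchAngle_comp hc ((lt_alphaAct_iff ha hb hc hc1 hcab).1 h) hφ
    · obtain rfl := (eq_alphaAct_iff ha hb hc hc1 hcab).1 h
      exact movesForwardWithTwoStops_intouchAngle_comp hφ hpt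
    · exact movesWithFourReversals_intouchAngle_comp ha hb
        ((alphaAct_lt_iff ha hb hc hc1 hcab).1 h) hc1 hφ hpt
  · intro ε hε
    refine ⟨min (1 / 10) (ε ^ 2 / 18), by positivity, fun a b hb hl hr T hT i θ hθ t ht => ?_⟩
    have hα := alphaAct_sq
    have hα0 := alphaAct_pos
    have hα1 : 1 < alphaAct := by nlinarith
    have hα2 : alphaAct < 13 / 10 := by nlinarith
    have hab : b < a := (one_lt_div hb).1 (hα1.trans hl)
    have ha : 0 < a := hb.trans hab
    obtain ⟨c, hc, hc1, hcab⟩ := exists_ponceletParameter hb hab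
    obtain ⟨φ, hφ, hpt⟩ := hT.exists_isCircleLift hb hab hc hc1 hcab i
    rw [hθ.deriv_eq ha.ne' hb.ne' (hcoord hc hc1 hφ hpt),
      deriv_intouchAngle_comp_eq_zero_iff hc hc1 hφ] at ht
    have hcos := cos_sq_intouchAngle_le_of_stop hb ((alphaAct_lt_iff ha hb hc hc1 hcab).1 hl) hc1
      hcab ht
    rw [hpt]
    refine dist_vertex_lt (by positivity) ?_
    have hx1 : a / b - alphaAct < 1 / 10 := by linarith [min_le_left (1 / 10) (ε ^ 2 / 18)]
    have hx2 : a / b - alphaAct < ε ^ 2 / 18 := by linarith [min_le_right (1 / 10) (ε ^ 2 / 18)]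
    have hab2 : a ^ 2 + b ^ 2 = ((a / b) ^ 2 + 1) * b ^ 2 := by field_simp
    rw [hab2, mul_right_comm, mul_pow]
    refine mul_lt_mul_of_pos_right ?_ (by positivity)
    set x := a / b
    have h1 : x ^ 2 + 1 ≤ 3 := by nlinarith
    have h2 : x ^ 2 - alphaAct ^ 2 ≤ 3 * (x - alphaAct) := by nlinarith
    calc (x ^ 2 + 1) * Real.cos (intouchAngle c (φ t)) ^ 2
        ≤ 3 * (2 * (3 * (x - alphaAct))) :=
          mul_le_mul h1 (by linarith) (sq_nonneg _) (by norm_num)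
      _ < ε ^ 2 := by linarith
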